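/- Let $G$ be a finite connected multigraph (loops and parallel edges allowed) that is cellularly embedded in the torus $T=\mathbb{R}^2/\mathbb{Z}^2$: the graph is embedded topologically, and it cuts $T$ into finitely many open 2-cells (faces), each with a closed boundary walk in $G$. Let $C_1(G)$ be the $\mathbb{Z}_2$-vector space on the edges of $G$. For $z\in C_1(G)$ let $G\!:\!z$ be the subgraph formed by the edges of $z$ and their end vertices; $z$ induces a circle if $G\!:\!z$ is a connected 2-regular graph (a loop counts twice in the degree). Let $Z(G)\subseteq C_1(G)$ be the subspace spanned by the chains that induce circles, let $B\subseteq Z(G)$ be the subspace spanned by the boundaries $\partial f$ of the faces $f$ (the coefficient of an edge in $\partial f$ is the number, modulo 2, of its occurrences in the boundary walk of $f$), and let $[z]$ denote the class of $z\in Z(G)$ in $H_1(T)=Z(G)/B$. For closed curves $\gamma_1,\gamma_2\colon \mathbb{R}/\mathbb{Z}\to T$, the $\mathbb{Z}_2$-intersection index is the residue modulo 2 of the number of pairs $(s,t)$ with $c_1(s)=c_2(t)$, where $c_1,c_2$ are smooth closed curves freely homotopic to $\gamma_1,\gamma_2$ and transverse to each other at every common point. If $z_1,z_2$ induce circles, $\langle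 z_1,z_2\rangle\in\mathbb{Z}_2$ is the intersection index of simple closed curves in $T$ that parametrize $G\!:\!z_1$ and $G\!:\!z_2$. Let $z_1,z_2\in Z(G)$ both induce circles, and suppose that $[z_1]\ne 0$, $[z_2]\ne 0$ and $[z_1]\neq[z_2]$ (that is, both are homologically nontrivial, and they are homologically independent). Then $\langle z_1,z_2\rangle=1$: the circles have parametrizations by simple closed curves, and for all such parametrizations $\gamma_1,\gamma_2$, curves $c_1,c_2$ as above exist and every such pair has a finite odd number of pairs $(s,t)$ with $c_1(s)=c_2(t)$. -/

import Mathlib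

open scoped ContDiff unitInterval

noncomputable section

/-! ### Multigraphs, circles and the cycle space over `ℤ/2` -/

/-- A multigraph (loops and parallel edges are allowed) with vertex set `V` and edge set `E`.
Every edge carries a reference direction, which fixes its positive dart; it plays no role in the
`ℤ/2`-chains below. -/
structure DirMultigraph (V E : Type*) where
  /-- The tail of the positive dart of an edge. -/
  tail : E → V
  /-- The head of the positive dart of an edge. -/
  head : E → V

namespace DirMultigraph

variable {V E : Type*} (G : DirMultigraph V E)

/-- Two vertices are joined by a walk (in arbitrary directions) all of whose edges lie in `X`. -/
def JoinedIn (X : Set E) : V → V → Prop :=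
  Relation.EqvGen fun a b => ∃ e ∈ X, G.tail e = a ∧ G.head e = b

/-- The graph is nonempty and connected. -/
def Connected : Prop := Nonempty V ∧ ∀ u v : V, G.JoinedIn Set.univ u v

/-- The vertices of the subgraph `G : X` induced by a set `X` of edges. -/
def inducedVertices (X : Set E) : Set V := {v | ∃ e ∈ X, G.tail e = v ∨ G.head e = v}

/-- The degree of a vertex in the subgraph `G : X`; a loop counts twice. -/
def inducedDegree (X : Set E) (v : V) : ℕ :=
  {e | e ∈ X ∧ G.tail e = v}.ncard + {e | e ∈ X ∧ G.head e = v}.ncard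

/-- The subgraph `G : X` is a circle, that is, a (nonempty) connected 2-regular graph. -/
def IsCircle (X : Set E) : Prop :=
  X.Nonempty ∧
  (∀ v ∈ G.inducedVertices X, G.inducedDegree X v = 2) ∧
  ∀ u ∈ G.inducedVertices X, ∀ v ∈ G.inducedVertices X, G.JoinedIn X u v

/-- The cycle space `Z(G)`: the subspace of the space `E → ZMod 2` of 1-chains that is generated by
the chains inducing circles. -/
def cycleSpace : Submodule (ZMod 2) (E → ZMod 2) :=
  Submodule.span (ZMod 2) {z | G.IsCircle (Function.support z)}

end DirMultigraph

/-! ### Cellular embeddings -/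

/-- A cellular embedding of the multigraph `G` in the space `S`, with set of faces `F`: the graph is
embedded topologically, and the rest of `S` is cut into open 2-cells, each one the image of the
open unit disc under a characteristic map from the closed disc whose restriction to the
boundary circle runs along a closed boundary walk in the graph. The boundary circle of a face
with a boundary walk of `n` darts is cut into `n` equal arcs, and the `k`-th one follows the
`k`-th dart. (A boundary walk without darts occurs only for a one-vertex graph in the
sphere, and is left out.) -/
structure CellularEmbedding {V E : Type*} (G : DirMultigraph V E) (F : Type*)
    (S : Type*) [TopologicalSpace S] where
  /-- The position of a vertex. -/
  pos : V → S
  /-- The arc that represents an edge, traversed along its positive dart. -/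
  arc : (e : E) → Path (pos (G.tail e)) (pos (G.head e))
  pos_injective : Function.Injective pos
  arc_injective : ∀ (e e' : E) (s t : I), 0 < s → s < 1 → arc e s = arc e' t → e = e' ∧ s = t
  arc_ne_pos : ∀ (e : E) (s : I) (v : V), 0 < s → s < 1 → arc e s ≠ pos v
  /-- The characteristic map of a face; only its values on the closed unit disc matter. -/
  cell : F → ℂ → S
  cell_continuousOn : ∀ f, ContinuousOn (cell f) (Metric.closedBall 0 1)
  cell_injective : ∀ f g, ∀ x ∈ Metric.ball (0 : ℂ) 1, ∀ y ∈ Metric.ball (0 : ℂ) 1,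
    cell f x = cell g y → f = g ∧ x = y
  cell_ne_pos : ∀ f, ∀ x ∈ Metric.ball (0 : ℂ) 1, ∀ v, cell f x ≠ pos v
  cell_ne_arc : ∀ f, ∀ x ∈ Metric.ball (0 : ℂ) 1, ∀ e s, cell f x ≠ arc e s
  /-- Vertices, edges and faces cover the space. -/
  cover : ∀ p : S, (∃ v, p = pos v) ∨ (∃ e s, p = arc e s) ∨
    ∃ f, ∃ x ∈ Metric.ball (0 : ℂ) 1, p = cell f x
  /-- The number of darts in the boundary walk of a face. -/
  len : F → ℕ
  len_pos : ∀ f, 0 < len f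
  /-- The boundary walk of a face: `(e, true)` is the positive dart of the edge `e` and
  `(e, false)` is the negative one. -/
  walk : (f : F) → Fin (len f) → E × Bool
  cell_boundary : ∀ (f : F) (k : Fin (len f)) (t : I),
    cell f (Circle.exp (2 * Real.pi * (((k : ℕ) : ℝ) + (t : ℝ)) / (len f : ℝ))) =
      if (walk f k).2 then arc (walk f k).1 t else arc (walk f k).1 (σ t)

namespace CellularEmbedding

variable {V E F S : Type*} [TopologicalSpace S] {G : DirMultigraph V E}
  (i : CellularEmbedding G F S)

/-- The boundary `∂ f` of a face: the coefficient of an edge is the number modulo 2 of its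
occurrences in the boundary walk of `f`. -/
def faceBoundary (f : F) : E → ZMod 2 :=
  fun e => (Nat.card {k : Fin (i.len f) // (i.walk f k).1 = e} : ZMod 2)

/-- The space of boundaries, generated by the boundaries of the faces. -/
def boundarySpace : Submodule (ZMod 2) (E → ZMod 2) :=
  Submodule.span (ZMod 2) (Set.range i.faceBoundary)

/-- The first homology group with `ℤ/2`-coefficients of the cell decomposition: cycles modulo
boundaries. -/
abbrev H1 : Type _ := G.cycleSpace ⧸ i.boundarySpace.submoduleOf G.cycleSpace

/-- The homology class `[z]` of a cycle `z`. -/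
def homologyClass (z : G.cycleSpace) : i.H1 :=
  (i.boundarySpace.submoduleOf G.cycleSpace).mkQ z

/-- The subset of the surface occupied by the subgraph `G : X`. -/
def carrier (X : Set E) : Set S := ⋃ e ∈ X, Set.range (i.arc e)

/-- `γ` is a simple closed curve in the surface that parametrizes the subgraph induced by the
1-chain `z`. -/
def Parametrizes (γ : C(UnitAddCircle, S)) (z : E → ZMod 2) : Prop :=
  Function.Injective γ ∧ Set.range γ = i.carrier (Function.support z)

end CellularEmbedding

/-! ### The torus and the mod 2 intersection index of closed curves on it -/

/-- The torus `ℝ²/ℤ²`. -/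
abbrev FlatTorus : Type := UnitAddCircle × UnitAddCircle

namespace FlatTorus

/-- `l` is a smooth lift to the plane of the closed curve `c`. -/
def IsSmoothLift (l : ℝ → ℝ × ℝ) (c : C(UnitAddCircle, FlatTorus)) : Prop :=
  ContDiff ℝ ∞ l ∧
  ∀ t : ℝ, c (t : UnitAddCircle) = (((l t).1 : UnitAddCircle), ((l t).2 : UnitAddCircle))

/-- Two closed curves on the torus are in general position: they are smooth, and they are
transverse at every common point, that is, their velocity vectors there are linearly
independent. (The velocities do not depend on the choice of the lifts.) -/
def GeneralPosition (c₁ c₂ : C(UnitAddCircle, FlatTorus)) : Prop :=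
  ∃ l₁ l₂ : ℝ → ℝ × ℝ, IsSmoothLift l₁ c₁ ∧ IsSmoothLift l₂ c₂ ∧
    ∀ s t : ℝ, c₁ (s : UnitAddCircle) = c₂ (t : UnitAddCircle) →
      LinearIndependent ℝ ![deriv l₁ s, deriv l₂ t]

/-- The common points of two closed curves, as pairs of parameters. -/
def crossings (c₁ c₂ : C(UnitAddCircle, FlatTorus)) : Set (UnitAddCircle × UnitAddCircle) :=
  {p | c₁ p.1 = c₂ p.2}

/-- The closed curves `γ₁`, `γ₂` have (well-defined) intersection index `k` modulo 2: they can be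
brought into general position by free homotopies, and however this is done, the number of
common points is finite and its residue modulo 2 is `k`. -/
def HasIntersectionIndex (γ₁ γ₂ : C(UnitAddCircle, FlatTorus)) (k : ZMod 2) : Prop :=
  (∃ c₁ c₂ : C(UnitAddCircle, FlatTorus),
    c₁.Homotopic γ₁ ∧ c₂.Homotopic γ₂ ∧ GeneralPosition c₁ c₂) ∧
  ∀ c₁ c₂ : C(UnitAddCircle, FlatTorus),
    c₁.Homotopic γ₁ → c₂.Homotopic γ₂ → GeneralPosition c₁ c₂ →
      (crossings c₁ c₂).Finite ∧ ((crossings c₁ c₂).ncard : ZMod 2) = k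

end FlatTorus

namespace CellularEmbedding

variable {V E F : Type*} {G : DirMultigraph V E} (i : CellularEmbedding G F FlatTorus)

/-- `⟨z₁, z₂⟩ = k` for two 1-chains inducing circles of a graph in the torus: the circles can be
parametrized as simple closed curves, and all parametrizations have intersection index `k`. -/
def HasIntersectionIndex (z₁ z₂ : E → ZMod 2) (k : ZMod 2) : Prop :=
  (∃ γ₁ γ₂ : C(UnitAddCircle, FlatTorus), i.Parametrizes γ₁ z₁ ∧ i.Parametrizes γ₂ z₂) ∧
  ∀ γ₁ γ₂ : C(UnitAddCircle, FlatTorus), i.Parametrizes γ₁ z₁ → i.Parametrizes γ₂ z₂ →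
    FlatTorus.HasIntersectionIndex γ₁ γ₂ k

end CellularEmbedding

end

/-!
Two independent facts make the intersection index odd.

*Homology.* By linear algebra, a chain that is not a boundary is detected by a cocycle: a function
`φ : E → ZMod 2` that sums to zero over every boundary walk (`mem_boundarySpace_of_forall`). Such a
`φ` defines a double covering of the torus, with a change of sheets along the edges with `φ e = 1`.
This covering is trivial over the plane, since the plane is simply connected; a trivialization is a
function `s` on the plane whose increment along every lifted edge `e` is `φ e` (`exists_potential`).
A lattice translation changes `s` by a constant. Hence the value of `φ` on a circle depends, in a
linear way, only on the displacement modulo 2 of a lift of a curve that parametrizes the circle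
(`exists_displacement_pairing`). If the displacement of `z₁` were zero modulo 2, or that of `z₂`, or
if they were equal modulo 2, then all cocycles would vanish on `z₁`, `z₂` or `z₁ - z₂`, which would
be a boundary. So the two displacements are linearly independent modulo 2, and their determinant is
odd.

*Intersections.* For smooth curves with lifts `l₁` and `l₂`, the crossings are the zeros modulo the
lattice of `(s, t) ↦ l₁ s - l₂ t`, and transversality means that the Jacobian does not vanish there.
The integral over a fundamental square of a doubly periodic bump, pulled back by this map, is on the
one hand the sum of the signs of the Jacobian at the crossings (`eventually_integral_eq_sum_sign`),
and on the other hand, by the divergence theorem, the determinant of the displacements up to sign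
(`integral_square_bump_mul_det`). So the number of crossings is odd. As displacements are invariant
under free homotopy, this holds for all curves in general position homotopic to the given ones, and
geodesics with the same displacements show that there are such curves.
-/

noncomputable section

open Set Filter Topology

/-! ### Locally constant cocycles and twisted sections -/

/-- The first Čech cohomology of a simply connected space with coefficients in `ℤ/2` vanishes:
functions on the members of an open cover whose differences are locally constant come from a single
function up to locally constant ones. The differences are the transition functions of a fibre bundle
with fibre `ℤ/2`, that is, of a covering, and the identity of `X` lifts to a section of it. -/
theorem exists_global_of_locally_constant_sub {X ι : Type*} [TopologicalSpace X]
    [SimplyConnectedSpace X] [LocallyPathConnectedSpace X] (U : ι → Set X)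
    (hU : ∀ i, IsOpen (U i)) (hcov : ∀ x, ∃ i, x ∈ U i) (s : ι → X → ZMod 2)
    (hs : ∀ i j, ∀ x ∈ U i ∩ U j, ∀ᶠ y in 𝓝 x, s i y - s j y = s i x - s j x) :
    ∃ t : X → ZMod 2, ∀ i, ∀ x ∈ U i, ∀ᶠ y in 𝓝 x, t y - s i y = t x - s i x := by
  choose idx hidx using hcov
  let Z : FiberBundleCore ι X (ZMod 2) :=
    { baseSet := U
      isOpen_baseSet := hU
      indexAt := idx
      mem_baseSet_at := hidx
      coordChange := fun i j x v => v + (s j x - s i x)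
      coordChange_self := fun i x _ v => by simp
      continuousOn_coordChange := fun i j => by
        rintro ⟨x, v⟩ ⟨hx, -⟩
        apply ContinuousAt.continuousWithinAt
        have h1 : ∀ᶠ p : X × ZMod 2 in 𝓝 (x, v), s j p.1 - s i p.1 = s j x - s i x :=
          (continuous_fst.tendsto (x, v)).eventually (hs j i x hx.symm)
        have h2 : ContinuousAt (fun p : X × ZMod 2 => p.2 + (s j x - s i x)) (x, v) := by
          fun_prop
        exact h2.congr (h1.mono fun p hp => by simp only [hp])
      coordChange_comp := fun i j k x _ v => by ring }
  have cov : IsCoveringMap (Bundle.TotalSpace.proj : Z.TotalSpace → X) :=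
    FiberBundle.isCoveringMap (F := ZMod 2) (E := Z.Fiber)
  obtain ⟨x₀⟩ : Nonempty X := inferInstance
  obtain ⟨F, ⟨-, hF⟩, -⟩ := cov.existsUnique_continuousMap_lifts (ContinuousMap.id X) x₀
    (⟨x₀, (0 : ZMod 2)⟩ : Z.TotalSpace) rfl
  have hproj : ∀ x, (F x).proj = x := fun x => congrFun hF x
  have hval : ∀ i y, (Z.localTriv i (F y)).2 =
      (show ZMod 2 from (F y).2) + (s i y - s (idx y) y) := by
    intro i y
    change (show ZMod 2 from (F y).2) + (s i (F y).proj - s (idx (F y).proj) (F y).proj) = _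
    rw [hproj]
  refine ⟨fun x => s (idx x) x - (show ZMod 2 from (F x).2), fun i x hx => ?_⟩
  have hc : ContinuousAt (fun y => (Z.localTriv i (F y)).2) x := by
    have h1 : ContinuousAt (Z.localTriv i) (F x) := by
      apply (Z.localTriv i).continuousAt
      rw [Z.mem_localTriv_source, ← Z.baseSet_at, hproj]
      exact hx
    exact (continuous_snd.continuousAt.comp h1).comp F.continuous.continuousAt
  have h2 : ∀ᶠ y in 𝓝 x, (Z.localTriv i (F y)).2 = (Z.localTriv i (F x)).2 :=
    hc.eventually ((isOpen_discrete {(Z.localTriv i (F x)).2}).mem_nhds rfl)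
  filter_upwards [h2] with y hy
  rw [hval, hval] at hy
  linear_combination -hy

/-- Think of `q : Y → T` as cutting `T` into pieces, and of `g : Y → ZMod 2` as the gluing data of a
double covering of `T` that is trivial over each piece. A function `r` on `T` is then a local section
of that double covering at `p` if `r ∘ q + g` is locally constant at all points of `Y` over `p`. -/
def IsTwistedSectionAt {Y T : Type*} [TopologicalSpace Y] (q : Y → T) (g : Y → ZMod 2)
    (r : T → ZMod 2) (p : T) : Prop :=
  ∀ y, q y = p → ∀ᶠ y' in 𝓝 y, r (q y') + g y' = r (q y) + g y

namespace IsTwistedSectionAt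

variable {Y T : Type*} [TopologicalSpace Y] [TopologicalSpace T] [CompactSpace Y] [T2Space T]
  {q : Y → T} {g : Y → ZMod 2}

/-- Being a section is an open condition, because `q` is a closed map. -/
theorem eventually (hq : Continuous q) {r : T → ZMod 2} {p : T}
    (h : IsTwistedSectionAt q g r p) : ∀ᶠ p' in 𝓝 p, IsTwistedSectionAt q g r p' := by
  let O : Set Y := {y | ∀ᶠ y' in 𝓝 y, r (q y') + g y' = r (q y) + g y}
  have hO : IsOpen O := by
    rw [isOpen_iff_mem_nhds]
    intro y hy
    have hy' : ∀ᶠ y' in 𝓝 y, r (q y') + g y' = r (q y) + g y := hy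
    filter_upwards [hy'.eventually_nhds] with y' hy'
    filter_upwards [hy'] with y'' hy''
    rw [hy'', hy'.self_of_nhds]
  have hcl : IsClosed (q '' Oᶜ) := hq.isClosedMap _ hO.isClosed_compl
  have hp : p ∈ (q '' Oᶜ)ᶜ := by
    rintro ⟨y, hy, hyp⟩
    exact hy (h y hyp)
  filter_upwards [hcl.isOpen_compl.mem_nhds hp] with p' hp' y hy
  by_contra hcon
  exact hp' ⟨y, hcon, hy⟩

/-- The difference of two sections is locally constant. -/
theorem eventually_sub_eq (hq : Continuous q) (hsurj : Function.Surjective q)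
    {r r' : T → ZMod 2} {p : T} (h : IsTwistedSectionAt q g r p)
    (h' : IsTwistedSectionAt q g r' p) : ∀ᶠ p' in 𝓝 p, r p' - r' p' = r p - r' p := by
  let B : Set Y := {y | r (q y) - r' (q y) ≠ r p - r' p}
  have hcl : IsClosed (q '' closure B) := hq.isClosedMap _ isClosed_closure
  have hp : p ∈ (q '' closure B)ᶜ := by
    rintro ⟨y, hy, hyp⟩
    rw [mem_closure_iff_frequently] at hy
    obtain ⟨y', hy', h1, h2⟩ := (hy.and_eventually ((h y hyp).and (h' y hyp))).exists
    apply hy'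
    rw [hyp] at h1 h2
    linear_combination h1 - h2
  filter_upwards [hcl.isOpen_compl.mem_nhds hp] with p' hp'
  by_contra hcon
  obtain ⟨y, rfl⟩ := hsurj p'
  exact hp' ⟨y, subset_closure hcon, rfl⟩

/-- If `q` and `g` admit local sections everywhere, then the double covering becomes trivial over any
simply connected `X`: a function `s` on `X` agrees with the pulled back local sections up to locally
constant functions. -/
theorem exists_pullback {X : Type*} [TopologicalSpace X] [SimplyConnectedSpace X]
    [LocallyPathConnectedSpace X] {π : X → T} (hπ : Continuous π) (hq : Continuous q)
    (hsurj : Function.Surjective q) (h : ∀ p, ∃ r, IsTwistedSectionAt q g r p) :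
    ∃ s : X → ZMod 2, ∀ p, ∃ r, IsTwistedSectionAt q g r p ∧
      ∀ x, π x = p → ∀ᶠ x' in 𝓝 x, s x' - r (π x') = s x - r (π x) := by
  choose r hr using h
  obtain ⟨s, hs⟩ := exists_global_of_locally_constant_sub (X := X)
    (fun p : T => π ⁻¹' {p' | IsTwistedSectionAt q g (r p) p'})
    (fun p => IsOpen.preimage hπ (isOpen_iff_mem_nhds.2 fun p' hp' => hp'.eventually hq))
    (fun x => ⟨π x, hr _⟩) (fun p x => r p (π x))
    (fun p p' x hx => (hπ.tendsto x).eventually (hx.1.eventually_sub_eq hq hsurj hx.2))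
  exact ⟨s, fun p => ⟨r p, hr p, fun x hx => hs p x (by simpa [hx] using hr p)⟩⟩

end IsTwistedSectionAt

/-! ### Boundary walks of faces and partial sums of a cocycle -/

namespace CellularEmbedding

variable {V E F S : Type*} [TopologicalSpace S] {G : DirMultigraph V E}
  (i : CellularEmbedding G F S) (φ : E → ZMod 2)

/-- The boundary walk of a face as a periodic sequence of darts indexed by the integers. -/
def dart (f : F) (k : ℤ) : E × Bool :=
  i.walk f ⟨(k % (i.len f : ℤ)).toNat, by
    have h := i.len_pos f
    have h1 := Int.emod_nonneg k (b := (i.len f : ℤ)) (by omega)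
    have h2 := Int.emod_lt_of_pos k (b := (i.len f : ℤ)) (by omega)
    omega⟩

theorem dart_natCast (f : F) (k : Fin (i.len f)) : i.dart f ((k : ℕ) : ℤ) = i.walk f k := by
  unfold dart
  congr 1
  ext
  have h1 : ((k : ℕ) : ℤ) % (i.len f : ℤ) = (k : ℕ) := Int.emod_eq_of_lt (by omega) (by omega)
  simp [h1]

theorem dart_add_mul_len (f : F) (k m : ℤ) : i.dart f (k + m * i.len f) = i.dart f k := by
  simp [dart]

/-- The sum of `φ` over the first `k` darts of the boundary walk of a face, continued periodically;
this is consistent when `φ` sums to zero over the whole walk. -/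
def walkSum (f : F) (k : ℤ) : ZMod 2 :=
  ∑ j ∈ Finset.range (k % (i.len f : ℤ)).toNat, φ (i.dart f j).1

theorem walkSum_add_mul_len (f : F) (k m : ℤ) :
    i.walkSum φ f (k + m * i.len f) = i.walkSum φ f k := by
  simp [walkSum]

variable {φ} in
theorem walkSum_add_one {f : F} (hφ : ∑ k, φ (i.walk f k).1 = 0) (k : ℤ) :
    i.walkSum φ f (k + 1) = i.walkSum φ f k + φ (i.dart f k).1 := by
  have hn := i.len_pos f
  have h1 := Int.emod_nonneg k (b := (i.len f : ℤ)) (by omega)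
  have h2 := Int.emod_lt_of_pos k (b := (i.len f : ℤ)) (by omega)
  have hd : i.dart f k = i.dart f ((k % (i.len f : ℤ)).toNat : ℤ) := by
    conv_lhs => rw [← Int.emod_add_ediv_mul k (i.len f), dart_add_mul_len]
    rw [Int.toNat_of_nonneg h1]
  rw [hd]
  unfold walkSum
  rw [← Finset.sum_range_succ (fun j : ℕ => φ (i.dart f j).1)]
  rcases lt_or_eq_of_le (Int.add_one_le_iff.2 h2) with h | h
  · have : (k + 1) % (i.len f : ℤ) = k % (i.len f : ℤ) + 1 := by
      rw [← Int.emod_add_emod]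
      exact Int.emod_eq_of_lt (by omega) h
    rw [this, Int.toNat_add h1 (by norm_num)]
    rfl
  · have : (k + 1) % (i.len f : ℤ) = 0 := by
      rw [← Int.emod_add_emod, h, Int.emod_self]
    have h3 : (k % (i.len f : ℤ)).toNat + 1 = i.len f := by omega
    have h4 : ∑ j ∈ Finset.range (i.len f), φ (i.dart f j).1 = 0 := by
      rw [Finset.sum_range]
      simpa only [dart_natCast] using hφ
    rw [this, h3, h4]
    rfl

/-- The gluing function of an edge in its arc parameter: vertices and edge interiors are compared
through the tail of the edge, so that the only jump, by `φ e`, is at the head. -/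
def edgeTwist (φ : E → ZMod 2) (e : E) (x : ℝ) : ZMod 2 :=
  open Classical in if x = 1 then φ e else 0

/-- The boundary curve of a face, parametrized so that the `k`-th dart of the boundary walk takes up
the interval `[k, k + 1]`. -/
def boundaryCurve (f : F) (x : ℝ) : S := i.cell f (Circle.exp (2 * Real.pi * x / i.len f))

theorem boundaryCurve_add_mul_len (f : F) (x : ℝ) (m : ℤ) :
    i.boundaryCurve f (x + m * i.len f) = i.boundaryCurve f x := by
  have hn : (i.len f : ℝ) ≠ 0 := by exact_mod_cast (i.len_pos f).ne'
  unfold boundaryCurve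
  exact congrArg (fun c : Circle => i.cell f c) (Circle.exp_eq_exp.2 ⟨m, by field_simp⟩)

theorem boundaryCurve_eq (f : F) (k : ℤ) {x : ℝ} (hx : x ∈ Icc (k : ℝ) (k + 1)) :
    i.boundaryCurve f x = (i.arc (i.dart f k).1).extend
      (if (i.dart f k).2 then x - k else 1 - (x - k)) := by
  have hn := i.len_pos f
  have h1 := Int.emod_nonneg k (b := (i.len f : ℤ)) (by omega)
  have h2 := Int.emod_lt_of_pos k (b := (i.len f : ℤ)) (by omega)
  have ht : x - k ∈ I := ⟨by linarith [hx.1], by linarith [hx.2]⟩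
  let j : Fin (i.len f) := ⟨(k % (i.len f : ℤ)).toNat, by omega⟩
  have hk : (k : ℝ) = ((j : ℕ) : ℝ) + (k / (i.len f : ℤ) : ℤ) * i.len f := by
    have h3 : k = ((j : ℕ) : ℤ) + (k / (i.len f : ℤ)) * i.len f := by
      change k = (((k % (i.len f : ℤ)).toNat : ℕ) : ℤ) + _
      rw [Int.toNat_of_nonneg h1, Int.emod_add_ediv_mul]
    exact_mod_cast h3
  have hb := i.cell_boundary f j ⟨x - k, ht⟩
  have hx' : x = ((j : ℕ) + (x - k)) + (k / (i.len f : ℤ) : ℤ) * i.len f := by linarith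
  rw [hx', boundaryCurve_add_mul_len, ← hx']
  unfold boundaryCurve
  refine hb.trans ?_
  change (if (i.dart f k).2 then i.arc (i.dart f k).1 _ else i.arc (i.dart f k).1 _) = _
  split_ifs
  · exact (Path.extend_apply _ ht).symm
  · have : 1 - (x - k) ∈ I := ⟨by linarith [ht.2], by linarith [ht.1]⟩
    exact (Path.extend_apply _ this).symm

/-- The gluing function of a face along its boundary curve: the partial sum of `φ` up to the tail of
the edge that is being traversed, corrected by the jump of that edge. -/
def boundaryTwist (f : F) (x : ℝ) : ZMod 2 :=
  if (i.dart f ⌊x⌋).2 then i.walkSum φ f ⌊x⌋ + edgeTwist φ (i.dart f ⌊x⌋).1 (x - ⌊x⌋)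
  else i.walkSum φ f (⌊x⌋ + 1) + edgeTwist φ (i.dart f ⌊x⌋).1 (1 - (x - ⌊x⌋))

theorem boundaryTwist_add_mul_len (f : F) (x : ℝ) (m : ℤ) :
    i.boundaryTwist φ f (x + m * i.len f) = i.boundaryTwist φ f x := by
  have h : ⌊x + m * i.len f⌋ = ⌊x⌋ + m * i.len f := by
    rw [← Int.floor_add_intCast]; push_cast; rfl
  have h' : ⌊x⌋ + m * (i.len f : ℤ) + 1 = (⌊x⌋ + 1) + m * i.len f := by ring
  unfold boundaryTwist
  rw [h, h', dart_add_mul_len, walkSum_add_mul_len, walkSum_add_mul_len]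
  push_cast
  simp only [add_sub_add_right_eq_sub]

variable {φ} in
/-- The formula for the twist on the `k`-th dart is valid at both ends of the dart; at the far end this
is the recursion for the partial sums. -/
theorem boundaryTwist_eq {f : F} (hφ : ∑ k, φ (i.walk f k).1 = 0) (k : ℤ) {x : ℝ}
    (hx : x ∈ Icc (k : ℝ) (k + 1)) :
    i.boundaryTwist φ f x = i.walkSum φ f (if (i.dart f k).2 then k else k + 1) +
      edgeTwist φ (i.dart f k).1 (if (i.dart f k).2 then x - k else 1 - (x - k)) := by
  have key := i.walkSum_add_one hφ
  rcases hx.2.lt_or_eq with h | h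
  · have : ⌊x⌋ = k := Int.floor_eq_iff.2 ⟨hx.1, h⟩
    unfold boundaryTwist
    rw [this]
    split_ifs <;> rfl
  · have h3 : ⌊x⌋ = k + 1 := by rw [h, Int.floor_add_one, Int.floor_intCast]
    unfold boundaryTwist
    rw [h3, h, key (k + 1), key k]
    have h0 : ∀ e, edgeTwist φ e 0 = 0 := fun e => by simp [edgeTwist]
    have h1 : ∀ e, edgeTwist φ e 1 = φ e := fun e => by simp [edgeTwist]
    have h2 : ∀ a : ZMod 2, a + a = 0 := fun a => CharTwo.add_self_eq_zero a
    have e1 : (k : ℝ) + 1 - ((k + 1 : ℤ) : ℝ) = 0 := by push_cast; ring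
    have e2 : (k : ℝ) + 1 - k = 1 := by ring
    rw [e1, e2]
    simp only [sub_zero, sub_self]
    split_ifs <;> simp only [h0, h1, key] <;> grind

end CellularEmbedding

/-! ### The potential of a cocycle -/

theorem norm_ofReal_mul_circleExp (ρ x : ℝ) : ‖(ρ * Circle.exp x : ℂ)‖ = |ρ| := by
  have h : ‖(Circle.exp x : ℂ)‖ = 1 := Circle.norm_coe _
  rw [norm_mul, h, mul_one, Complex.norm_real, Real.norm_eq_abs]

/-- A property holds near `x` if it does so within each of the (at most two) closed unit intervals
with integer endpoints that contain `x`. -/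
theorem eventually_nhds_of_unit_intervals {x : ℝ} {P : ℝ → Prop}
    (h : ∀ k : ℤ, x ∈ Icc (k : ℝ) (k + 1) → ∀ᶠ y in 𝓝[Icc (k : ℝ) (k + 1)] x, P y) :
    ∀ᶠ y in 𝓝 x, P y := by
  rw [← nhdsLE_sup_nhdsGE, eventually_sup]
  constructor
  · have h1 := Int.ceil_lt_add_one x
    have h2 := Int.le_ceil x
    have h3 : ((⌈x⌉ - 1 : ℤ) : ℝ) = ⌈x⌉ - 1 := by push_cast; ring
    refine (h (⌈x⌉ - 1) (by constructor <;> rw [h3] <;> linarith)).filter_mono ?_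
    rw [← nhdsWithin_Icc_eq_nhdsLE (a := ((⌈x⌉ - 1 : ℤ) : ℝ)) (by rw [h3]; linarith)]
    exact nhdsWithin_mono _ (Icc_subset_Icc le_rfl (by rw [h3]; linarith))
  · have h1 := Int.lt_floor_add_one x
    have h2 := Int.floor_le x
    refine (h ⌊x⌋ ⟨h2, h1.le⟩).filter_mono ?_
    rw [← nhdsWithin_Icc_eq_nhdsGE h1]
    exact nhdsWithin_mono _ (Icc_subset_Icc h2 le_rfl)

namespace CellularEmbedding

variable {V E F S : Type*} [TopologicalSpace S] {G : DirMultigraph V E}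
  (i : CellularEmbedding G F S) {φ : E → ZMod 2}

/-- Near a point of the graph, the double covering defined by `φ` has a section over the graph: zero
near an interior point of an edge, and near a vertex zero on the first half and `φ e` on the second
half of each edge `e`. -/
theorem exists_edge_section (φ : E → ZMod 2) {p : S}
    (hp : (∃ v, p = i.pos v) ∨ ∃ e s, p = i.arc e s) :
    ∃ r : S → ZMod 2, ∀ e (t : I), i.arc e t = p → ∀ᶠ t' in 𝓝 t,
      r (i.arc e t') + edgeTwist φ e t' = r (i.arc e t) + edgeTwist φ e t := by
  classical
  have hvert : ∀ v, ∃ r : S → ZMod 2, ∀ e (t : I), i.arc e t = i.pos v → ∀ᶠ t' in 𝓝 t,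
      r (i.arc e t') + edgeTwist φ e t' = r (i.arc e t) + edgeTwist φ e t := by
    intro v
    let r : S → ZMod 2 := fun w =>
      if h : ∃ a : E × I, 0 < a.2 ∧ a.2 < 1 ∧ (1 / 2 : ℝ) ≤ a.2 ∧ w = i.arc a.1 a.2
      then φ h.choose.1 else 0
    have r_end : ∀ (e : E) (t : I), t = 0 ∨ t = 1 → r (i.arc e t) = 0 := by
      intro e t ht
      refine dif_neg ?_
      rintro ⟨a, h0, h1, -, ha⟩
      rcases ht with rfl | rfl
      · exact i.arc_ne_pos a.1 a.2 _ h0 h1 (ha.symm.trans (i.arc e).source)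
      · exact i.arc_ne_pos a.1 a.2 _ h0 h1 (ha.symm.trans (i.arc e).target)
    have r_lt : ∀ (e : E) (t : I), (t : ℝ) < 1 / 2 → r (i.arc e t) = 0 := by
      intro e t ht
      refine dif_neg ?_
      rintro ⟨a, h0, h1, h2, ha⟩
      have := (i.arc_injective a.1 e a.2 t h0 h1 ha.symm).2
      rw [this] at h2
      linarith
    have r_gt : ∀ (e : E) (t : I), (1 / 2 : ℝ) ≤ t → t < 1 → r (i.arc e t) = φ e := by
      intro e t ht ht1
      have h : ∃ a : E × I, 0 < a.2 ∧ a.2 < 1 ∧ (1 / 2 : ℝ) ≤ a.2 ∧ i.arc e t = i.arc a.1 a.2 :=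
        ⟨(e, t), Subtype.coe_lt_coe.1 (by rw [Set.Icc.coe_zero]; linarith), ht1, ht, rfl⟩
      have h' : r (i.arc e t) = φ h.choose.1 := dif_pos h
      obtain ⟨h0, h1, h2, h3⟩ := h.choose_spec
      rw [h', (i.arc_injective _ _ _ _ h0 h1 h3.symm).1]
    refine ⟨r, fun e t ht => ?_⟩
    have ht' : t = 0 ∨ t = 1 := by
      by_contra! hcon
      exact i.arc_ne_pos e t v (lt_of_le_of_ne t.2.1 (Ne.symm hcon.1))
        (lt_of_le_of_ne t.2.2 hcon.2) ht
    rcases ht' with rfl | rfl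
    · have : ∀ᶠ t' : I in 𝓝 0, (t' : ℝ) < 1 / 2 :=
        (continuous_subtype_val.tendsto (0 : I)).eventually_lt_const (by norm_num)
      filter_upwards [this] with t' ht'
      rw [r_lt e t' ht', r_end e 0 (Or.inl rfl)]
      have h1 : (t' : ℝ) ≠ 1 := by linarith
      simp [edgeTwist, h1]
    · have : ∀ᶠ t' : I in 𝓝 1, (1 / 2 : ℝ) < t' :=
        (continuous_subtype_val.tendsto (1 : I)).eventually_const_lt (by norm_num)
      filter_upwards [this] with t' ht'
      rcases eq_or_ne t' 1 with rfl | h1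
      · rfl
      · rw [r_gt e t' ht'.le (lt_of_le_of_ne t'.2.2 h1), r_end e 1 (Or.inr rfl)]
        have h1 : (t' : ℝ) ≠ 1 := fun h => h1 (Subtype.ext h)
        simp [edgeTwist, h1]
  rcases hp with ⟨v, rfl⟩ | ⟨e₀, t₀, rfl⟩
  · exact hvert v
  · by_cases h0 : t₀ = 0
    · subst h0; simpa using hvert (G.tail e₀)
    by_cases h1 : t₀ = 1
    · subst h1; simpa using hvert (G.head e₀)
    refine ⟨0, fun e t ht => ?_⟩
    have h1 : t₀ < 1 := lt_of_le_of_ne t₀.2.2 h1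
    obtain ⟨rfl, rfl⟩ := i.arc_injective e₀ e t₀ t (lt_of_le_of_ne t₀.2.1 (Ne.symm h0)) h1 ht.symm
    filter_upwards [eventually_lt_nhds h1] with t' ht'
    have h2 : (t' : ℝ) ≠ 1 := fun h => ht'.ne (Subtype.ext h)
    have h3 : (t₀ : ℝ) ≠ 1 := fun h => h1.ne (Subtype.ext h)
    simp [edgeTwist, h2, h3]

/-- A section over the graph is also a section along the boundary curve of every face over which `φ`
sums to zero. -/
theorem boundary_section {f : F} (hφ : ∑ k, φ (i.walk f k).1 = 0) {p : S} {r : S → ZMod 2}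
    (hr : ∀ e (t : I), i.arc e t = p → ∀ᶠ t' in 𝓝 t,
      r (i.arc e t') + edgeTwist φ e t' = r (i.arc e t) + edgeTwist φ e t)
    {x : ℝ} (hx : i.boundaryCurve f x = p) :
    ∀ᶠ x' in 𝓝 x, r (i.boundaryCurve f x') + i.boundaryTwist φ f x' =
      r (i.boundaryCurve f x) + i.boundaryTwist φ f x := by
  refine eventually_nhds_of_unit_intervals fun k hk => ?_
  let τ : ℝ → I := fun x' =>
    projIcc 0 1 zero_le_one (if (i.dart f k).2 then x' - k else 1 - (x' - k))
  have hτ : Continuous τ := by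
    refine continuous_projIcc.comp ?_
    split_ifs <;> fun_prop
  have hmem : ∀ x' ∈ Icc (k : ℝ) (k + 1),
      ((τ x' : I) : ℝ) = if (i.dart f k).2 then x' - k else 1 - (x' - k) := by
    intro x' hx'
    refine congrArg Subtype.val (projIcc_of_mem zero_le_one ?_)
    split_ifs <;> constructor <;> linarith [hx'.1, hx'.2]
  have hval : ∀ x' ∈ Icc (k : ℝ) (k + 1),
      r (i.boundaryCurve f x') + i.boundaryTwist φ f x' =
      r (i.arc (i.dart f k).1 (τ x')) + edgeTwist φ (i.dart f k).1 (τ x') +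
        i.walkSum φ f (if (i.dart f k).2 then k else k + 1) := by
    intro x' hx'
    rw [i.boundaryCurve_eq f k hx', i.boundaryTwist_eq hφ k hx', hmem x' hx']
    change r (i.arc (i.dart f k).1 (τ x')) + _ = _
    ring
  have harc : i.arc (i.dart f k).1 (τ x) = p := by
    rw [← hx, i.boundaryCurve_eq f k hk]; rfl
  have := (hτ.tendsto x).eventually (hr _ _ harc)
  filter_upwards [mem_nhdsWithin_of_mem_nhds this, self_mem_nhdsWithin] with x' h1 h2
  rw [hval x' h2, hval x hk, h1]

/-- A function on the graph is extended to the punctured open faces so that, in the trivialization of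
each face, it is constant along radii. -/
theorem exists_radial_extension (φ : E → ZMod 2) (r : S → ZMod 2) : ∃ r' : S → ZMod 2,
    (∀ w, (∀ f, ∀ z ∈ Metric.ball (0 : ℂ) 1, i.cell f z ≠ w) → r' w = r w) ∧
    ∀ f (ρ u : ℝ), 0 < ρ → ρ < 1 → r' (i.cell f (ρ * Circle.exp (2 * Real.pi * u))) =
      r (i.boundaryCurve f (i.len f * u)) + i.boundaryTwist φ f (i.len f * u) := by
  classical
  let r' : S → ZMod 2 := fun w =>
    if h : ∃ a : F × ℝ × ℝ, 0 < a.2.1 ∧ a.2.1 < 1 ∧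
        w = i.cell a.1 (a.2.1 * Circle.exp (2 * Real.pi * a.2.2))
    then r (i.boundaryCurve h.choose.1 (i.len h.choose.1 * h.choose.2.2)) +
      i.boundaryTwist φ h.choose.1 (i.len h.choose.1 * h.choose.2.2) else r w
  have hball : ∀ ρ u : ℝ, 0 < ρ → ρ < 1 →
      (ρ * Circle.exp (2 * Real.pi * u) : ℂ) ∈ Metric.ball (0 : ℂ) 1 := by
    intro ρ u h0 h1
    rwa [mem_ball_zero_iff, norm_ofReal_mul_circleExp, abs_of_pos h0]
  refine ⟨r', fun w hw => ?_, fun f ρ u h0 h1 => ?_⟩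
  · refine dif_neg ?_
    rintro ⟨a, h0, h1, ha⟩
    exact hw _ _ (hball _ _ h0 h1) ha.symm
  · have h : ∃ a : F × ℝ × ℝ, 0 < a.2.1 ∧ a.2.1 < 1 ∧
        i.cell f (ρ * Circle.exp (2 * Real.pi * u)) =
          i.cell a.1 (a.2.1 * Circle.exp (2 * Real.pi * a.2.2)) := ⟨(f, ρ, u), h0, h1, rfl⟩
    have h' : r' (i.cell f (ρ * Circle.exp (2 * Real.pi * u))) = _ := dif_pos h
    rw [h']
    obtain ⟨h2, h3, h4⟩ := h.choose_spec
    generalize h.choose = a at h2 h3 h4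
    obtain ⟨f', ρ', u'⟩ := a
    dsimp only at h2 h3 h4 ⊢
    obtain ⟨rfl, h5⟩ := i.cell_injective _ _ _ (hball _ _ h0 h1) _ (hball _ _ h2 h3) h4
    have h6 : ρ = ρ' := by
      have := congrArg norm h5
      rwa [norm_ofReal_mul_circleExp, norm_ofReal_mul_circleExp, abs_of_pos h0,
        abs_of_pos h2] at this
    subst h6
    have h7 : Circle.exp (2 * Real.pi * u) = Circle.exp (2 * Real.pi * u') :=
      Circle.ext (mul_left_cancel₀ (by exact_mod_cast h0.ne') h5)
    obtain ⟨m, hm⟩ := Circle.exp_eq_exp.1 h7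
    have h8 : u = u' + m := by
      have := Real.pi_pos
      have h9 : 2 * Real.pi * u = 2 * Real.pi * (u' + m) := by rw [hm]; ring
      exact mul_left_cancel₀ (by positivity) h9
    rw [h8, mul_add, mul_comm (i.len f : ℝ) m, boundaryCurve_add_mul_len,
      boundaryTwist_add_mul_len]

/-- The surface as the image of finitely many compact pieces: the faces in polar coordinates `(u, ρ)`
with the angle measured in full turns, the edges and the vertices. -/
def coverMap : (F × I × I) ⊕ (E × I) ⊕ V → S
  | .inl (f, u, ρ) => i.cell f (ρ * Circle.exp (2 * Real.pi * u))
  | .inr (.inl (e, t)) => i.arc e t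
  | .inr (.inr v) => i.pos v

/-- The gluing function on the pieces that `coverMap` glues together. -/
def coverTwist (φ : E → ZMod 2) : (F × I × I) ⊕ (E × I) ⊕ V → ZMod 2
  | .inl (f, u, ρ) => open Classical in if ρ = 1 then i.boundaryTwist φ f (i.len f * u) else 0
  | .inr (.inl (e, t)) => edgeTwist φ e t
  | .inr (.inr _) => 0

theorem coverMap_surjective : Function.Surjective i.coverMap := by
  intro p
  rcases i.cover p with ⟨v, rfl⟩ | ⟨e, s, rfl⟩ | ⟨f, x, hx, rfl⟩
  · exact ⟨.inr (.inr v), rfl⟩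
  · exact ⟨.inr (.inl (e, s)), rfl⟩
  · have hx' : ‖x‖ ≤ 1 := by simpa using (Metric.mem_ball.1 hx).le
    obtain ⟨u, hu⟩ : ∃ u : I, x = ‖x‖ * Circle.exp (2 * Real.pi * u) := by
      have hpi := Real.pi_pos
      obtain ⟨w, hw⟩ : ∃ w : Circle, x = ‖x‖ * w := by
        rcases eq_or_ne x 0 with rfl | h0
        · exact ⟨1, by simp⟩
        · refine ⟨⟨x / ‖x‖, by simp [Submonoid.unitSphere, h0]⟩, ?_⟩
          have : (‖x‖ : ℂ) ≠ 0 := by simpa using h0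
          field_simp
      have hex : Circle.exp (2 * Real.pi * Int.fract (Complex.arg w / (2 * Real.pi))) = w := by
        rw [← Circle.exp_arg w, Circle.exp_eq_exp]
        refine ⟨-⌊Complex.arg w / (2 * Real.pi)⌋, ?_⟩
        rw [Circle.exp_arg, Int.fract]
        push_cast
        field_simp
        ring
      exact ⟨⟨Int.fract (Complex.arg w / (2 * Real.pi)), Int.fract_nonneg _,
        (Int.fract_lt_one _).le⟩, by rw [hex]; exact hw⟩
    exact ⟨.inl (f, u, ⟨‖x‖, norm_nonneg x, hx'⟩), congrArg (i.cell f) hu.symm⟩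

theorem coverMap_continuous [TopologicalSpace V] [DiscreteTopology V] [TopologicalSpace E]
    [DiscreteTopology E] [TopologicalSpace F] [DiscreteTopology F] : Continuous i.coverMap := by
  refine continuous_sum_dom.2 ⟨?_, continuous_sum_dom.2 ⟨?_, ?_⟩⟩
  · rw [continuous_prod_of_discrete_left]
    intro f
    refine (i.cell_continuousOn f).comp_continuous
      (f := fun a : I × I => ((a.2 : ℝ) * Circle.exp (2 * Real.pi * a.1) : ℂ)) (by fun_prop) ?_
    rintro ⟨u, ρ⟩
    rw [mem_closedBall_zero_iff, norm_ofReal_mul_circleExp, abs_of_nonneg ρ.2.1]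
    exact ρ.2.2
  · rw [continuous_prod_of_discrete_left]
    intro e
    exact (i.arc e).continuous
  · exact continuous_of_discreteTopology

variable {i} in
/-- The double covering defined by a cocycle is locally trivial. At a point of the graph, the section
over the graph is extended radially into the faces; only boundary points of faces lie over such a
point. -/
theorem exists_isTwistedSectionAt [TopologicalSpace V] [DiscreteTopology V] [TopologicalSpace E]
    [DiscreteTopology E] [TopologicalSpace F] [DiscreteTopology F]
    (hφ : ∀ f, ∑ k, φ (i.walk f k).1 = 0) (p : S) :
    ∃ r, IsTwistedSectionAt i.coverMap (i.coverTwist φ) r p := by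
  have hball : ∀ (u ρ : I), ρ < 1 →
      (ρ * Circle.exp (2 * Real.pi * u) : ℂ) ∈ Metric.ball (0 : ℂ) 1 := by
    intro u ρ h1
    rw [mem_ball_zero_iff, norm_ofReal_mul_circleExp, abs_of_nonneg ρ.2.1]
    exact h1
  have hbdry : ∀ f (u : I), i.coverMap (.inl (f, u, 1)) = i.boundaryCurve f (i.len f * u) := by
    intro f u
    have hn : (i.len f : ℝ) ≠ 0 := by exact_mod_cast (i.len_pos f).ne'
    have h : 2 * Real.pi * (i.len f * u) / i.len f = 2 * Real.pi * u := by field_simp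
    simp only [coverMap, boundaryCurve, Set.Icc.coe_one, Complex.ofReal_one, one_mul]
    rw [h]
  by_cases hp : ∃ f, ∃ z ∈ Metric.ball (0 : ℂ) 1, p = i.cell f z
  · obtain ⟨f₀, z₀, hz₀, rfl⟩ := hp
    refine ⟨0, ?_⟩
    rintro (⟨f, u, ρ⟩ | ⟨e, t⟩ | v) hy
    · have hρ : ρ < 1 := by
        refine lt_of_le_of_ne ρ.2.2 ?_
        rintro rfl
        rw [hbdry, i.boundaryCurve_eq f _ ⟨Int.floor_le _, (Int.lt_floor_add_one _).le⟩] at hy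
        exact i.cell_ne_arc f₀ z₀ hz₀ _ _ hy.symm
      rw [nhds_inl, eventually_map]
      have : ∀ᶠ y' : F × I × I in 𝓝 (f, u, ρ), y'.2.2 < 1 :=
        (continuous_snd.comp continuous_snd).continuousAt.eventually_lt continuousAt_const hρ
      filter_upwards [this] with y' hy'
      simp [coverTwist, hy'.ne, hρ.ne]
    · exact absurd hy.symm (i.cell_ne_arc f₀ z₀ hz₀ e t)
    · exact absurd hy.symm (i.cell_ne_pos f₀ z₀ hz₀ v)
  · have hp' : (∃ v, p = i.pos v) ∨ ∃ e s, p = i.arc e s := by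
      rcases i.cover p with h | h | h
      exacts [Or.inl h, Or.inr h, absurd h hp]
    obtain ⟨r, hr⟩ := i.exists_edge_section φ hp'
    obtain ⟨r', hr', hrad⟩ := i.exists_radial_extension φ r
    have harc : ∀ e t, r' (i.arc e t) = r (i.arc e t) := fun e t =>
      hr' _ fun f z hz => i.cell_ne_arc f z hz e t
    refine ⟨r', ?_⟩
    rintro (⟨f, u, ρ⟩ | ⟨e, t⟩ | v) hy
    · have hρ : ρ = 1 := by
        by_contra hne
        exact hp ⟨f, _, hball u ρ (lt_of_le_of_ne ρ.2.2 hne), hy.symm⟩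
      subst hρ
      have hval : ∀ (u' ρ' : I), 0 < ρ' →
          r' (i.coverMap (.inl (f, u', ρ'))) + i.coverTwist φ (.inl (f, u', ρ')) =
          r (i.boundaryCurve f (i.len f * u')) + i.boundaryTwist φ f (i.len f * u') := by
        intro u' ρ' h0
        by_cases h1 : ρ' = 1
        · subst h1
          have : r' (i.coverMap (.inl (f, u', 1))) = r (i.boundaryCurve f (i.len f * u')) := by
            rw [hbdry, i.boundaryCurve_eq f _ ⟨Int.floor_le _, (Int.lt_floor_add_one _).le⟩]
            exact harc _ _
          rw [this]
          simp [coverTwist]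
        · have := hrad f ρ' u' h0 (lt_of_le_of_ne ρ'.2.2 fun h => h1 (Subtype.ext h))
          simp only [coverMap, coverTwist, h1, if_false, add_zero]
          exact this
      rw [hbdry] at hy
      have h1 := ((continuous_const.mul continuous_subtype_val).tendsto' u _ rfl).eventually
        (i.boundary_section (hφ f) hr hy)
      rw [nhds_inl, eventually_map, nhds_prod_eq, nhds_discrete, pure_prod, eventually_map]
      have h2 : ∀ᶠ y' : I × I in 𝓝 (u, 1), 0 < y'.2 :=
        continuousAt_const.eventually_lt continuous_snd.continuousAt zero_lt_one
      filter_upwards [h2, (continuous_fst.tendsto ((u, 1) : I × I)).eventually h1] with y' h3 h4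
      rw [hval _ _ h3, hval _ _ zero_lt_one]
      exact h4
    · rw [nhds_inr, eventually_map, nhds_inl, eventually_map, nhds_prod_eq, nhds_discrete,
        pure_prod, eventually_map]
      filter_upwards [hr e t hy] with t' ht'
      simpa only [coverMap, coverTwist, harc] using ht'
    · rw [nhds_inr, eventually_map, nhds_inr, eventually_map, nhds_discrete, eventually_pure]

variable {i} in
/-- A cocycle `φ` becomes a coboundary on every simply connected space `X` over the surface: it is the
increment along lifted edges of a function `s` on `X`. Deck transformations change `s` by constants. -/
theorem exists_potential [Finite V] [Finite E] [Finite F] [T2Space S] {X : Type*}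
    [TopologicalSpace X] [SimplyConnectedSpace X] [LocallyPathConnectedSpace X] {π : X → S}
    (hπ : Continuous π) (hφ : ∀ f, ∑ k, φ (i.walk f k).1 = 0) :
    ∃ s : X → ZMod 2,
      (∀ e (a : I → X), Continuous a → (∀ t, π (a t) = i.arc e t) → s (a 1) = s (a 0) + φ e) ∧
      ∀ τ : X → X, Continuous τ → (∀ x, π (τ x) = π x) → ∃ c, ∀ x, s (τ x) = s x + c := by
  let _ : TopologicalSpace V := ⊥
  let _ : TopologicalSpace E := ⊥
  let _ : TopologicalSpace F := ⊥
  have _ : DiscreteTopology V := ⟨rfl⟩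
  have _ : DiscreteTopology E := ⟨rfl⟩
  have _ : DiscreteTopology F := ⟨rfl⟩
  obtain ⟨s, hs⟩ := IsTwistedSectionAt.exists_pullback (X := X) hπ i.coverMap_continuous
    i.coverMap_surjective (exists_isTwistedSectionAt hφ)
  refine ⟨s, fun e a ha hea => ?_, fun τ hτ hπτ => ?_⟩
  · have hloc : IsLocallyConstant fun t : I => s (a t) + edgeTwist φ e t := by
      rw [IsLocallyConstant.iff_eventually_eq]
      intro t
      obtain ⟨r, hr, hsr⟩ := hs (i.arc e t)
      have h1 := hr (.inr (.inl (e, t))) rfl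
      rw [nhds_inr, eventually_map, nhds_inl, eventually_map, nhds_prod_eq, nhds_discrete,
        pure_prod, eventually_map] at h1
      filter_upwards [h1, (ha.tendsto t).eventually (hsr (a t) (hea t))] with t' h1 h2
      simp only [coverMap, coverTwist] at h1
      rw [hea, hea] at h2
      linear_combination h2 + h1
    have := hloc.apply_eq_of_preconnectedSpace 0 1
    simp only [edgeTwist, Set.Icc.coe_zero, Set.Icc.coe_one, if_true, zero_ne_one, if_false] at this
    grind
  · have hloc : IsLocallyConstant fun x => s (τ x) - s x := by
      rw [IsLocallyConstant.iff_eventually_eq]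
      intro x
      obtain ⟨r, hr, hsr⟩ := hs (π x)
      filter_upwards [hsr x rfl, (hτ.tendsto x).eventually (hsr (τ x) (hπτ x))] with x' h1 h2
      rw [hπτ, hπτ] at h2
      linear_combination h2 - h1
    obtain ⟨x₀⟩ : Nonempty X := inferInstance
    exact ⟨s (τ x₀) - s x₀, fun x => by
      have := hloc.apply_eq_of_preconnectedSpace x x₀
      linear_combination this⟩

end CellularEmbedding

/-! ### A circle as a closed walk -/

namespace DirMultigraph

variable {V E : Type*} (G : DirMultigraph V E)

/-- The initial vertex of a dart. -/
def src (d : E × Bool) : V := if d.2 then G.tail d.1 else G.head d.1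

/-- The same edge traversed in the opposite direction. -/
def revDart (d : E × Bool) : E × Bool := (d.1, !d.2)

theorem revDart_revDart (d : E × Bool) : revDart (revDart d) = d := by simp [revDart]

theorem revDart_ne (d : E × Bool) : revDart d ≠ d := fun h => by
  simpa [revDart] using congrArg Prod.snd h

theorem eq_or_eq_revDart {d d' : E × Bool} (h : d.1 = d'.1) : d = d' ∨ d = revDart d' := by
  obtain ⟨e, b⟩ := d
  obtain ⟨e', b'⟩ := d'
  dsimp only at h
  subst h
  cases b <;> cases b' <;> simp [revDart]

variable {G}

theorem ncard_darts_eq_inducedDegree [Finite E] (X : Set E) (v : V) :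
    {d : E × Bool | d.1 ∈ X ∧ G.src d = v}.ncard = G.inducedDegree X v := by
  have h : {d : E × Bool | d.1 ∈ X ∧ G.src d = v} =
      (fun e => (e, true)) '' {e | e ∈ X ∧ G.tail e = v} ∪
      (fun e => (e, false)) '' {e | e ∈ X ∧ G.head e = v} := by
    ext ⟨e, b⟩
    cases b <;> simp [src]
  have hd : Disjoint ((fun e => (e, true)) '' {e | e ∈ X ∧ G.tail e = v})
      ((fun e => (e, false)) '' {e | e ∈ X ∧ G.head e = v}) := by
    rw [Set.disjoint_left]
    rintro _ ⟨e, -, rfl⟩ ⟨e', -, h⟩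
    simp at h
  rw [h, Set.ncard_union_eq hd (Set.toFinite _) (Set.toFinite _),
    Set.ncard_image_of_injective _ (fun a b h => congrArg Prod.fst h),
    Set.ncard_image_of_injective _ (fun a b h => congrArg Prod.fst h)]
  rfl

/-- In a 2-regular graph, every dart has exactly one other dart with the same initial vertex. -/
theorem IsCircle.exists_other_dart [Finite E] {X : Set E} (hX : G.IsCircle X) (d : E × Bool)
    (hd : d.1 ∈ X) : ∃ d' : E × Bool, d'.1 ∈ X ∧ d' ≠ d ∧ G.src d' = G.src d ∧
      ∀ d'' : E × Bool, d''.1 ∈ X → G.src d'' = G.src d → d'' = d ∨ d'' = d' := by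
  have hv : G.src d ∈ G.inducedVertices X := by
    refine ⟨d.1, hd, ?_⟩
    unfold src
    split_ifs
    exacts [Or.inl rfl, Or.inr rfl]
  have h2 := hX.2.1 _ hv
  rw [← ncard_darts_eq_inducedDegree, Set.ncard_eq_two] at h2
  obtain ⟨a, b, hab, hS⟩ := h2
  have hmem : ∀ d'' : E × Bool, (d''.1 ∈ X ∧ G.src d'' = G.src d) ↔ d'' = a ∨ d'' = b :=
    fun d'' => by simpa using Set.ext_iff.1 hS d''
  rcases (hmem d).1 ⟨hd, rfl⟩ with h | h
  · obtain ⟨h1, h2⟩ := (hmem b).2 (Or.inr rfl)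
    exact ⟨b, h1, by rw [h]; exact hab.symm, h2, fun d'' h3 h4 => h ▸ (hmem d'').1 ⟨h3, h4⟩⟩
  · obtain ⟨h1, h2⟩ := (hmem a).2 (Or.inl rfl)
    exact ⟨a, h1, by rw [h]; exact hab, h2, fun d'' h3 h4 => h ▸ ((hmem d'').1 ⟨h3, h4⟩).symm⟩

/-- A circle is traversed by a periodic walk that repeats neither an edge nor a vertex within a
period. The walk is an orbit of the permutation `next` which reverses a dart and then passes to the
other dart with the same initial vertex. Conjugation by the reversal inverts `next`, so an orbit
never contains the reverse of one of its darts; by connectedness it uses all edges. -/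
theorem IsCircle.exists_closed_walk [Finite E] {X : Set E} (hX : G.IsCircle X) :
    ∃ (n : ℕ) (d : ℤ → E × Bool), 0 < n ∧ (∀ k, d (k + n) = d k) ∧
      (∀ k, G.src (revDart (d k)) = G.src (d (k + 1))) ∧
      (∀ e, e ∈ X ↔ ∃ k, (d k).1 = e) ∧
      (∀ k l, (d k).1 = (d l).1 → (n : ℤ) ∣ k - l) ∧
      ∀ k l, G.src (d k) = G.src (d l) → (n : ℤ) ∣ k - l := by
  let D := {d : E × Bool // d.1 ∈ X}
  choose o ho hne hsrc huniq using hX.exists_other_dart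
  let oppFun : D → D := fun d => ⟨o d.1 d.2, ho d.1 d.2⟩
  have hopp : Function.Involutive oppFun := by
    intro d
    apply Subtype.ext
    rcases huniq (oppFun d).1 (oppFun d).2 d.1 d.2 (hsrc d.1 d.2).symm with h | h
    · exact absurd h.symm (hne d.1 d.2)
    · exact h.symm
  let revFun : D → D := fun d => ⟨revDart d.1, d.2⟩
  have hrev : Function.Involutive revFun := fun d => Subtype.ext (revDart_revDart d.1)
  let opp : Equiv.Perm D := hopp.toPerm
  let rev : Equiv.Perm D := hrev.toPerm
  have hoo : opp * opp = 1 := Equiv.ext hopp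
  have hrr : rev * rev = 1 := Equiv.ext hrev
  let next : Equiv.Perm D := opp * rev
  have hconj : rev * next * rev⁻¹ = next⁻¹ := by
    apply eq_inv_of_mul_eq_one_left
    have : rev⁻¹ = rev := inv_eq_of_mul_eq_one_left hrr
    rw [this]
    calc rev * (opp * rev) * rev * (opp * rev) = rev * opp * (rev * rev) * opp * rev := by group
      _ = 1 := by rw [hrr, mul_one, mul_assoc rev, hoo, mul_one, hrr]
  have hpow : ∀ (m : ℤ) (x : D), (next ^ m) (rev x) = rev ((next ^ (-m)) x) := by
    intro m x
    have h1 : rev * next ^ (-m) * rev⁻¹ = next ^ m := by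
      rw [← conj_zpow, hconj, inv_zpow', neg_neg]
    rw [← h1]
    simp
  obtain ⟨e₀, he₀⟩ := hX.1
  let x₀ : D := ⟨(e₀, true), he₀⟩
  let d : ℤ → D := fun k => (next ^ k) x₀
  have hd1 : ∀ k m, d (m + k) = (next ^ m) (d k) := fun k m => by
    simp only [d, zpow_add, Equiv.Perm.mul_apply]
  have hds : ∀ k, d (k + 1) = opp (rev (d k)) := fun k => by
    rw [add_comm, hd1, zpow_one]; rfl
  have hrevne : ∀ k l, d k ≠ rev (d l) := by
    intro k l h
    have h1 : ∀ m, d (k + m) = rev (d (l - m)) := by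
      intro m
      rw [add_comm, hd1, h, hpow, ← hd1, neg_add_eq_sub]
    -- Walking on from `d k` retraces the walk before `d l`, until both meet in the middle: at a dart
    -- that is its own reverse, or at a vertex that the walk leaves by the dart it came along.
    rcases Int.even_or_odd' (l - k) with ⟨m, hm | hm⟩
    · have := h1 m
      rw [show k + m = l - m by omega] at this
      exact revDart_ne _ (congrArg Subtype.val this).symm
    · have := h1 (m + 1)
      rw [show k + (m + 1) = (l - (m + 1)) + 1 by omega, hds] at this
      exact hne _ (rev (d (l - (m + 1)))).2 (congrArg Subtype.val this)
  have hadj : ∀ k, G.src (revDart (d k).1) = G.src (d (k + 1)).1 := by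
    intro k
    rw [hds]
    exact (hsrc _ (rev (d k)).2).symm
  have hstar : ∀ (k : ℤ) (δ : D), G.src δ.1 = G.src (d k).1 → δ = d k ∨ δ = rev (d (k - 1)) := by
    intro k δ h
    have hk : d k = opp (rev (d (k - 1))) := by rw [← hds, sub_add_cancel]
    have hk' : rev (d (k - 1)) = opp (d k) := by rw [hk]; exact (hopp _).symm
    rw [hk']
    rcases huniq (d k).1 (d k).2 δ.1 δ.2 h with h | h
    exacts [Or.inl (Subtype.ext h), Or.inr (Subtype.ext h)]
  have hW : ∀ (k : ℤ) (δ : D), G.src δ.1 = G.src (d k).1 →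
      (∃ l, (d l).1.1 = δ.1.1) ∧ ∃ l, G.src (d l).1 = G.src (revDart δ.1) := by
    intro k δ h
    rcases hstar k δ h with rfl | rfl
    · exact ⟨⟨k, rfl⟩, k + 1, (hadj k).symm⟩
    · refine ⟨⟨k - 1, rfl⟩, k - 1, ?_⟩
      change _ = G.src (revDart (revDart _))
      rw [revDart_revDart]
  have hjoin : ∀ u v, G.JoinedIn X u v →
      ((∃ k, G.src (d k).1 = u) ↔ ∃ k, G.src (d k).1 = v) := by
    intro u v h
    induction h with
    | rel a b h =>
      obtain ⟨e, he, rfl, rfl⟩ := h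
      constructor
      · rintro ⟨k, hk⟩
        exact (hW k ⟨(e, true), he⟩ hk.symm).2
      · rintro ⟨k, hk⟩
        exact (hW k ⟨(e, false), he⟩ hk.symm).2
    | refl => exact Iff.rfl
    | symm _ _ _ ih => exact ih.symm
    | trans _ _ _ _ _ ih1 ih2 => exact ih1.trans ih2
  have hsurj : ∀ e ∈ X, ∃ k, (d k).1.1 = e := by
    intro e he
    obtain ⟨k, hk⟩ := (hjoin _ _ (hX.2.2 (G.tail e₀) ⟨e₀, he₀, Or.inl rfl⟩ (G.tail e)
      ⟨e, he, Or.inl rfl⟩)).1 ⟨0, by simp [d, x₀, src]⟩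
    exact (hW k ⟨(e, true), he⟩ hk.symm).1
  let n := Function.minimalPeriod next x₀
  have hper : ∀ k l, d k = d l ↔ (n : ℤ) ∣ k - l := by
    intro k l
    have := MulAction.zpow_smul_eq_iff_minimalPeriod_dvd (a := next) (b := x₀) (n := k - l)
    rw [show n = Function.minimalPeriod (next • ·) x₀ from rfl, ← this]
    have h1 : d k = (next ^ l) ((next ^ (k - l)) x₀) := by
      rw [← Equiv.Perm.mul_apply, ← zpow_add]; congr 2; ring
    rw [h1]
    exact (next ^ l).injective.eq_iff
  refine ⟨n, fun k => (d k).1, ?_, fun k => ?_, hadj, fun e => ⟨hsurj e, ?_⟩, fun k l h => ?_,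
    fun k l h => ?_⟩
  · exact Function.minimalPeriod_pos_of_mem_periodicPts
      (Function.Injective.mem_periodicPts next.injective x₀)
  · exact congrArg Subtype.val ((hper (k + n) k).2 (by simp))
  · rintro ⟨k, rfl⟩
    exact (d k).2
  · rcases eq_or_eq_revDart h with h | h
    · exact (hper k l).1 (Subtype.ext h)
    · exact absurd (Subtype.ext h) (hrevne k l)
  · rcases hstar l (d k) h with h | h
    · exact (hper k l).1 h
    · exact absurd h (hrevne k _)

end DirMultigraph

/-! ### Parametrizing a circle by a simple closed curve -/

namespace CellularEmbedding

variable {V E F S : Type*} [TopologicalSpace S] {G : DirMultigraph V E}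
  (i : CellularEmbedding G F S)

open DirMultigraph

/-- The point at parameter `t` of the arc traversed along a dart. -/
def dartPoint (d : E × Bool) (t : ℝ) : S := (i.arc d.1).extend (if d.2 then t else 1 - t)

theorem continuous_dartPoint (d : E × Bool) : Continuous (i.dartPoint d) := by
  refine (i.arc d.1).continuous_extend.comp ?_
  split_ifs <;> fun_prop

theorem dartPoint_zero (d : E × Bool) : i.dartPoint d 0 = i.pos (G.src d) := by
  unfold dartPoint src
  split_ifs <;> simp

theorem dartPoint_one (d : E × Bool) : i.dartPoint d 1 = i.pos (G.src (revDart d)) := by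
  obtain ⟨e, b⟩ := d
  cases b <;> simp [dartPoint, src, revDart]

/-- The curve in the surface that follows the `k`-th dart of a sequence on the interval
`[k, k + 1]`. -/
def walkCurve (d : ℤ → E × Bool) (x : ℝ) : S := i.dartPoint (d ⌊x⌋) (x - ⌊x⌋)

variable {d : ℤ → E × Bool} {n : ℕ}

variable {i} in
theorem walkCurve_eq (hadj : ∀ k, G.src (revDart (d k)) = G.src (d (k + 1))) (k : ℤ) {x : ℝ}
    (hx : x ∈ Icc (k : ℝ) (k + 1)) : i.walkCurve d x = i.dartPoint (d k) (x - k) := by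
  rcases hx.2.lt_or_eq with h | h
  · have : ⌊x⌋ = k := Int.floor_eq_iff.2 ⟨hx.1, h⟩
    rw [walkCurve, this]
  · have h3 : ⌊x⌋ = k + 1 := by rw [h, Int.floor_add_one, Int.floor_intCast]
    rw [walkCurve, h3, h]
    push_cast
    rw [sub_self, add_sub_cancel_left, dartPoint_zero, dartPoint_one, hadj]

theorem continuous_walkCurve (hadj : ∀ k, G.src (revDart (d k)) = G.src (d (k + 1))) :
    Continuous (i.walkCurve d) := by
  rw [continuous_iff_continuousAt]
  intro x
  refine fun N hN => eventually_nhds_of_unit_intervals fun k hk => ?_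
  have hc : ContinuousWithinAt (i.walkCurve d) (Icc (k : ℝ) (k + 1)) x := by
    refine ContinuousWithinAt.congr ?_ (fun y hy => walkCurve_eq hadj k hy)
      (walkCurve_eq hadj k hk)
    exact ((i.continuous_dartPoint (d k)).comp (continuous_sub_right _)).continuousWithinAt
  exact hc hN

theorem walkCurve_add_mul (hper : ∀ k, d (k + n) = d k) (x : ℝ) :
    i.walkCurve d (x + n) = i.walkCurve d x := by
  have h : ⌊x + n⌋ = ⌊x⌋ + n := Int.floor_add_natCast x n
  rw [walkCurve, h, hper]
  push_cast
  rw [add_sub_add_right_eq_sub, walkCurve]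

/-- The curve of a walk that repeats neither edges nor vertices within a period takes the same value
only at parameters that differ by a multiple of the period. -/
theorem eq_add_of_walkCurve_eq (hedge : ∀ k l, (d k).1 = (d l).1 → (n : ℤ) ∣ k - l)
    (hvert : ∀ k l, G.src (d k) = G.src (d l) → (n : ℤ) ∣ k - l)
    (hper : ∀ k l, (n : ℤ) ∣ k - l → d k = d l) {x y : ℝ}
    (h : i.walkCurve d x = i.walkCurve d y) : ∃ m : ℤ, x - y = n * m := by
  have key : ∀ x y : ℝ, i.walkCurve d x = i.walkCurve d y → 0 < x - ⌊x⌋ →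
      ∃ m : ℤ, x - y = n * m := by
    intro x y h hx
    have hx1 : x - ⌊x⌋ < 1 := by linarith [Int.lt_floor_add_one x]
    have hy0 : 0 ≤ y - ⌊y⌋ := by linarith [Int.floor_le y]
    have hy1 : y - ⌊y⌋ < 1 := by linarith [Int.lt_floor_add_one y]
    let s : I := ⟨if (d ⌊x⌋).2 then x - ⌊x⌋ else 1 - (x - ⌊x⌋), by
      split_ifs <;> constructor <;> linarith⟩
    let t : I := ⟨if (d ⌊y⌋).2 then y - ⌊y⌋ else 1 - (y - ⌊y⌋), by
      split_ifs <;> constructor <;> linarith⟩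
    have hs : i.walkCurve d x = i.arc (d ⌊x⌋).1 s := Path.extend_apply _ s.2
    have ht : i.walkCurve d y = i.arc (d ⌊y⌋).1 t := Path.extend_apply _ t.2
    have hs0 : 0 < s := by
      rw [← Subtype.coe_lt_coe]
      change 0 < ite _ _ _
      split_ifs <;> linarith
    have hs1 : s < 1 := by
      rw [← Subtype.coe_lt_coe]
      change ite _ _ _ < 1
      split_ifs <;> linarith
    obtain ⟨he, hst⟩ := i.arc_injective _ _ s t hs0 hs1 (hs.symm.trans (h.trans ht))
    have hdvd := hedge _ _ he
    have hst' : (if (d ⌊x⌋).2 then x - ⌊x⌋ else 1 - (x - ⌊x⌋)) =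
      if (d ⌊y⌋).2 then y - ⌊y⌋ else 1 - (y - ⌊y⌋) := congrArg Subtype.val hst
    rw [hper _ _ hdvd] at hst'
    obtain ⟨m, hm⟩ := hdvd
    have hm' : ((⌊x⌋ : ℤ) : ℝ) - ⌊y⌋ = n * m := by exact_mod_cast hm
    refine ⟨m, ?_⟩
    split_ifs at hst' <;> linarith
  rcases (sub_nonneg.2 (Int.floor_le x)).eq_or_lt' with hx | hx
  · rcases (sub_nonneg.2 (Int.floor_le y)).eq_or_lt' with hy | hy
    · rw [walkCurve, walkCurve, hx, hy, dartPoint_zero, dartPoint_zero] at h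
      obtain ⟨m, hm⟩ := hvert _ _ (i.pos_injective h)
      have hm' : ((⌊x⌋ : ℤ) : ℝ) - ⌊y⌋ = n * m := by exact_mod_cast hm
      exact ⟨m, by linarith⟩
    · obtain ⟨m, hm⟩ := key y x h.symm hy
      exact ⟨-m, by push_cast; linarith⟩
  · exact key x y h hx

theorem range_walkCurve {X : Set E} (hadj : ∀ k, G.src (revDart (d k)) = G.src (d (k + 1)))
    (hX : ∀ e, e ∈ X ↔ ∃ k, (d k).1 = e) : range (i.walkCurve d) = i.carrier X := by
  apply Subset.antisymm
  · rintro _ ⟨x, rfl⟩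
    exact mem_biUnion ((hX _).2 ⟨⌊x⌋, rfl⟩) ⟨_, rfl⟩
  · refine iUnion₂_subset fun e he => ?_
    rintro _ ⟨t, rfl⟩
    obtain ⟨k, rfl⟩ := (hX e).1 he
    have ht : (if (d k).2 then (t : ℝ) else 1 - t) ∈ I := by
      split_ifs <;> constructor <;> linarith [t.2.1, t.2.2]
    refine ⟨k + if (d k).2 then (t : ℝ) else 1 - t, ?_⟩
    rw [walkCurve_eq hadj k ⟨by linarith [ht.1], by linarith [ht.2]⟩, add_sub_cancel_left]
    have : (if (d k).2 then (if (d k).2 then (t : ℝ) else 1 - t)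
        else 1 - if (d k).2 then (t : ℝ) else 1 - t) = t := by
      split_ifs <;> ring
    rw [dartPoint, this]
    exact Path.extend_apply _ t.2

/-- A potential of `φ` increases along a lifted walk by the sum of `φ` over its edges, in whichever
directions they are traversed, because the coefficients are in `ℤ/2`. -/
theorem potential_walkCurve {X : Type*} [TopologicalSpace X] {π : X → S} {s : X → ZMod 2}
    {φ : E → ZMod 2} (hadj : ∀ k, G.src (revDart (d k)) = G.src (d (k + 1)))
    (hs : ∀ e (a : I → X), Continuous a → (∀ t, π (a t) = i.arc e t) → s (a 1) = s (a 0) + φ e)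
    {l : ℝ → X} (hl : Continuous l) (hπ : ∀ x, π (l x) = i.walkCurve d x) (m : ℕ) :
    s (l m) = s (l 0) + ∑ k ∈ Finset.range m, φ (d k).1 := by
  induction m with
  | zero => simp
  | succ m ih =>
    rw [Finset.sum_range_succ, ← add_assoc, ← ih]
    have hmem : ∀ t : I, (m : ℝ) + t ∈ Icc (((m : ℤ)) : ℝ) ((m : ℤ) + 1) := fun t => by
      constructor <;> push_cast <;> linarith [t.2.1, t.2.2]
    by_cases hd : (d m).2
    · have := hs (d m).1 (fun t => l (m + t)) (by fun_prop) (fun t => by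
        rw [hπ, walkCurve_eq hadj m (hmem t), dartPoint, if_pos hd, Int.cast_natCast,
          add_sub_cancel_left]
        exact Path.extend_apply _ t.2)
      simpa using this
    · have := hs (d m).1 (fun t => l (m + ((unitInterval.symm t : I) : ℝ))) (by fun_prop)
        (fun t => by
        rw [hπ, walkCurve_eq hadj m (hmem _), dartPoint, if_neg hd, Int.cast_natCast,
          add_sub_cancel_left, unitInterval.coe_symm_eq, sub_sub_cancel]
        exact Path.extend_apply _ t.2)
      simp only [unitInterval.symm_one, unitInterval.symm_zero, Set.Icc.coe_zero,
        Set.Icc.coe_one, add_zero] at this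
      push_cast
      rw [this, add_assoc, CharTwo.add_self_eq_zero, add_zero]

/-- A circle has a parametrization by a simple closed curve, and a potential of `φ` increases along a
lift of this curve by the value of `φ` on the circle. -/
theorem exists_parametrization [Fintype E] {z : E → ZMod 2}
    (hz : G.IsCircle (Function.support z)) (X : Type*) [TopologicalSpace X] :
    ∃ γ : C(UnitAddCircle, S), i.Parametrizes γ z ∧
      ∀ (π : X → S) (s : X → ZMod 2) (φ : E → ZMod 2),
        (∀ e (a : I → X), Continuous a → (∀ t, π (a t) = i.arc e t) →
          s (a 1) = s (a 0) + φ e) →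
        ∀ l : ℝ → X, Continuous l → (∀ t : ℝ, π (l t) = γ t) →
          s (l 1) = s (l 0) + ∑ e, z e * φ e := by
  obtain ⟨n, d, hn, hper, hadj, hX, hedge, hvert⟩ := hz.exists_closed_walk
  have hn' : (n : ℝ) ≠ 0 := by exact_mod_cast hn.ne'
  have hper' : ∀ k l, (n : ℤ) ∣ k - l → d k = d l := by
    rintro k l ⟨m, hm⟩
    have hp : Function.Periodic d (n : ℤ) := hper
    have := hp.int_mul m l
    rw [← this]
    congr 1
    simp only [Int.cast_id]
    linarith
  have hperiodic : Function.Periodic (fun x : ℝ => i.walkCurve d (n * x)) 1 := by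
    intro x
    simp only [mul_add, mul_one]
    exact i.walkCurve_add_mul hper _
  have hcont : Continuous (fun x : ℝ => i.walkCurve d (n * x)) :=
    (i.continuous_walkCurve hadj).comp (continuous_const_mul _)
  let γ : C(UnitAddCircle, S) := ⟨hperiodic.lift, continuous_coinduced_dom.2 hcont⟩
  have hγ : ∀ x : ℝ, γ (x : UnitAddCircle) = i.walkCurve d (n * x) := fun x =>
    hperiodic.lift_coe x
  refine ⟨γ, ⟨?_, ?_⟩, ?_⟩
  · intro x y
    induction x using QuotientAddGroup.induction_on with | _ x
    induction y using QuotientAddGroup.induction_on with | _ y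
    intro h
    obtain ⟨m, hm⟩ := i.eq_add_of_walkCurve_eq hedge hvert hper' ((hγ x).symm.trans (h.trans (hγ y)))
    have h1 : x - y = m := mul_left_cancel₀ hn' (by linarith)
    rw [← sub_eq_zero]
    change ((x - y : ℝ) : UnitAddCircle) = 0
    rw [h1, AddCircle.coe_eq_zero_iff]
    exact ⟨m, by simp⟩
  · rw [← i.range_walkCurve hadj hX]
    apply Subset.antisymm
    · rintro _ ⟨x, rfl⟩
      induction x using QuotientAddGroup.induction_on with | _ x
      exact ⟨n * x, (hγ x).symm⟩
    · rintro _ ⟨x, rfl⟩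
      exact ⟨((x / n : ℝ) : UnitAddCircle), by rw [hγ, mul_div_cancel₀ _ hn']⟩
  · intro π s φ hs l hl hπ
    have h := i.potential_walkCurve hadj hs (l := fun x => l (x / n)) (by fun_prop)
      (fun x => by rw [hπ, hγ, mul_div_cancel₀ _ hn']) n
    rw [div_self hn', zero_div] at h
    rw [h]
    congr 1
    have h01 : ∀ a : ZMod 2, a ≠ 0 → a = 1 := by decide
    have h1 : ∑ e, z e * φ e = ∑ e with z e ≠ 0, φ e := by
      rw [Finset.sum_filter]
      refine Finset.sum_congr rfl fun e _ => ?_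
      split_ifs with h
      · rw [h01 _ h, one_mul]
      · rw [not_not.1 h, zero_mul]
    rw [h1]
    refine Finset.sum_bij (fun k _ => (d k).1) (fun k _ => ?_) (fun k hk l hl h => ?_)
      (fun e he => ?_) (fun _ _ => rfl)
    · exact Finset.mem_filter.2 ⟨Finset.mem_univ _, (hX _).2 ⟨k, rfl⟩⟩
    · rw [Finset.mem_range] at hk hl
      have h3 := Int.eq_zero_of_abs_lt_dvd (hedge _ _ h) (by rw [abs_lt]; omega)
      omega
    · obtain ⟨k, hk⟩ := (hX e).1 (Finset.mem_filter.1 he).2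
      have h1 := Int.emod_nonneg k (b := (n : ℤ)) (by omega)
      have h2 := Int.emod_lt_of_pos k (b := (n : ℤ)) (by omega)
      refine ⟨(k % n).toNat, Finset.mem_range.2 (by omega), ?_⟩
      rw [Int.toNat_of_nonneg h1, ← hk]
      rw [hper' (k % n) k ⟨-(k / n), by have := Int.emod_add_mul_ediv k n; linarith⟩]

end CellularEmbedding

/-! ### Lifts and displacements of closed curves on the torus -/

theorem exists_int_eq_of_continuous {X : Type*} [TopologicalSpace X] [PreconnectedSpace X]
    [Nonempty X] {f : X → ℝ} (hf : Continuous f) (h : ∀ x, ∃ m : ℤ, f x = m) :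
    ∃ m : ℤ, ∀ x, f x = m := by
  choose g hg using h
  have hgc : Continuous g := by
    refine Int.isClosedEmbedding_coe_real.isInducing.continuous_iff.2 ?_
    exact hf.congr hg
  obtain ⟨x₀⟩ := ‹Nonempty X›
  exact ⟨g x₀, fun x => by rw [hg, PreconnectedSpace.constant ‹_› hgc]⟩

namespace FlatTorus

/-- The universal covering of the torus. -/
def proj (x : ℝ × ℝ) : FlatTorus := ((x.1 : UnitAddCircle), (x.2 : UnitAddCircle))

theorem continuous_proj : Continuous proj :=
  ((AddCircle.continuous_mk' 1).comp continuous_fst).prodMk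
    ((AddCircle.continuous_mk' 1).comp continuous_snd)

/-- A pair of integers as a vector of the period lattice. -/
def latticeVec (A : ℤ × ℤ) : ℝ × ℝ := (A.1, A.2)

theorem coe_unitAddCircle_eq_iff {x y : ℝ} :
    (x : UnitAddCircle) = y ↔ ∃ m : ℤ, x - y = m := by
  rw [← sub_eq_zero, ← AddCircle.coe_sub, AddCircle.coe_eq_zero_iff]
  simp only [zsmul_eq_mul, mul_one]
  exact exists_congr fun _ => eq_comm

theorem proj_eq_proj_iff {x y : ℝ × ℝ} : proj x = proj y ↔ ∃ A, x - y = latticeVec A := by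
  simp only [proj, coe_unitAddCircle_eq_iff, latticeVec, Prod.exists, Prod.ext_iff,
    Prod.fst_sub, Prod.snd_sub, exists_and_left, exists_and_right]

theorem proj_add_latticeVec (x : ℝ × ℝ) (A : ℤ × ℤ) : proj (x + latticeVec A) = proj x :=
  proj_eq_proj_iff.2 ⟨A, by simp⟩

theorem exists_circle_lift {A : Type*} [TopologicalSpace A] [SimplyConnectedSpace A]
    [LocallyPathConnectedSpace A] {f : A → UnitAddCircle} (hf : Continuous f) :
    ∃ l : A → ℝ, Continuous l ∧ ∀ a, (l a : UnitAddCircle) = f a := by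
  obtain ⟨a₀⟩ : Nonempty A := inferInstance
  obtain ⟨e₀, he₀⟩ := QuotientAddGroup.mk_surjective (f a₀)
  obtain ⟨l, ⟨-, hl⟩, -⟩ := (AddCircle.isCoveringMap_coe (1 : ℝ)).existsUnique_continuousMap_lifts
    ⟨f, hf⟩ a₀ e₀ he₀
  exact ⟨l, l.continuous, fun a => congrFun hl a⟩

theorem exists_lift {A : Type*} [TopologicalSpace A] [SimplyConnectedSpace A]
    [LocallyPathConnectedSpace A] {f : A → FlatTorus} (hf : Continuous f) :
    ∃ l : A → ℝ × ℝ, Continuous l ∧ ∀ a, proj (l a) = f a := by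
  obtain ⟨l₁, h₁, h₁'⟩ := exists_circle_lift (continuous_fst.comp hf)
  obtain ⟨l₂, h₂, h₂'⟩ := exists_circle_lift (continuous_snd.comp hf)
  exact ⟨fun a => (l₁ a, l₂ a), h₁.prodMk h₂, fun a => Prod.ext (h₁' a) (h₂' a)⟩

theorem exists_latticeVec_eq_of_continuous {X : Type*} [TopologicalSpace X] [PreconnectedSpace X]
    [Nonempty X] {f : X → ℝ × ℝ} (hf : Continuous f) (h : ∀ x, ∃ A, f x = latticeVec A) :
    ∃ A, ∀ x, f x = latticeVec A := by
  choose A hA using h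
  obtain ⟨m, hm⟩ := exists_int_eq_of_continuous (continuous_fst.comp hf)
    fun x => ⟨(A x).1, by rw [Function.comp_apply, hA]; rfl⟩
  obtain ⟨n, hn⟩ := exists_int_eq_of_continuous (continuous_snd.comp hf)
    fun x => ⟨(A x).2, by rw [Function.comp_apply, hA]; rfl⟩
  exact ⟨(m, n), fun x => Prod.ext (hm x) (hn x)⟩

/-- `l` is a continuous lift to the plane of the closed curve `c`. -/
def IsLift (l : ℝ → ℝ × ℝ) (c : C(UnitAddCircle, FlatTorus)) : Prop :=
  Continuous l ∧ ∀ t : ℝ, proj (l t) = c t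

theorem exists_isLift (c : C(UnitAddCircle, FlatTorus)) : ∃ l, IsLift l c :=
  exists_lift (c.continuous.comp (AddCircle.continuous_mk' 1))

theorem exists_displacement (c : C(UnitAddCircle, FlatTorus)) :
    ∃ A, ∀ l, IsLift l c → ∀ t, l (t + 1) = l t + latticeVec A := by
  obtain ⟨l₀, hl₀⟩ := exists_isLift c
  obtain ⟨A, hA⟩ := exists_latticeVec_eq_of_continuous (f := fun t => l₀ (t + 1) - l₀ t)
    (by have := hl₀.1; fun_prop) (fun t => proj_eq_proj_iff.1 (by
      rw [hl₀.2, hl₀.2, AddCircle.coe_add_period]))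
  refine ⟨A, fun l hl t => ?_⟩
  obtain ⟨B, hB⟩ := exists_latticeVec_eq_of_continuous (f := fun t => l t - l₀ t)
    (by have := hl₀.1; have := hl.1; fun_prop) (fun t => proj_eq_proj_iff.1 (by
      rw [hl₀.2, hl.2]))
  have h1 := hB (t + 1)
  rw [← hB t, sub_eq_sub_iff_sub_eq_sub, hA t] at h1
  rw [← h1]
  abel

/-- The homotopy class of a closed curve on the torus, as the vector by which its lifts are displaced
over one period. -/
def displacement (c : C(UnitAddCircle, FlatTorus)) : ℤ × ℤ := (exists_displacement c).choose

theorem IsLift.add_one {l : ℝ → ℝ × ℝ} {c : C(UnitAddCircle, FlatTorus)} (hl : IsLift l c) (t : ℝ) :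
    l (t + 1) = l t + latticeVec (displacement c) :=
  (exists_displacement c).choose_spec l hl t

theorem latticeVec_injective : Function.Injective latticeVec := by
  rintro ⟨a, b⟩ ⟨a', b'⟩ h
  simpa [latticeVec, Prod.ext_iff] using h

theorem IsLift.displacement_eq {l : ℝ → ℝ × ℝ} {c : C(UnitAddCircle, FlatTorus)} (hl : IsLift l c)
    {A : ℤ × ℤ} (h : l 1 = l 0 + latticeVec A) : displacement c = A := by
  have := hl.add_one 0
  rw [zero_add, h] at this
  exact latticeVec_injective (add_left_cancel this).symm

theorem displacement_eq_of_homotopic {c c' : C(UnitAddCircle, FlatTorus)} (h : c.Homotopic c') :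
    displacement c = displacement c' := by
  obtain ⟨H⟩ := h
  obtain ⟨L, hL, hLH⟩ := exists_lift (A := ℝ × ℝ)
    (f := fun p => H (projIcc 0 1 zero_le_one p.1, (p.2 : UnitAddCircle)))
    (H.continuous.comp ((continuous_projIcc.comp continuous_fst).prodMk
      ((AddCircle.continuous_mk' 1).comp continuous_snd)))
  obtain ⟨A, hA⟩ := exists_latticeVec_eq_of_continuous
    (f := fun p : ℝ × ℝ => L (p.1, p.2 + 1) - L p) (by fun_prop) (fun p => proj_eq_proj_iff.1 (by
      rw [hLH, hLH, AddCircle.coe_add_period]))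
  have h0 : IsLift (fun t => L (0, t)) c := ⟨by fun_prop, fun t => by
    rw [hLH]; simp⟩
  have h1 : IsLift (fun t => L (1, t)) c' := ⟨by fun_prop, fun t => by
    rw [hLH]; simp⟩
  rw [h0.displacement_eq (A := A) (by simpa [sub_eq_iff_eq_add'] using hA (0, 0)),
    h1.displacement_eq (A := A) (by simpa [sub_eq_iff_eq_add'] using hA (1, 0))]

/-- The closed geodesic through the origin with a given displacement. -/
def linearCurve (A : ℤ × ℤ) : C(UnitAddCircle, FlatTorus) where
  toFun x := (A.1 • x, A.2 • x)
  continuous_toFun := by fun_prop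

theorem linearCurve_coe (A : ℤ × ℤ) (t : ℝ) : linearCurve A t = proj (t • latticeVec A) := by
  simp [linearCurve, proj, latticeVec, ← AddCircle.coe_zsmul, mul_comm]

/-- A closed curve is homotopic to the geodesic with the same displacement: the difference of a lift
and the linear map with this displacement is periodic, and is scaled down to zero. -/
theorem linearCurve_homotopic (c : C(UnitAddCircle, FlatTorus)) :
    (linearCurve (displacement c)).Homotopic c := by
  obtain ⟨l, hl⟩ := exists_isLift c
  have hper : Function.Periodic (fun t => l t - t • latticeVec (displacement c)) 1 := by
    intro t
    simp only [hl.add_one t, add_smul, one_smul]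
    abel
  have hcont : Continuous hper.lift := by
    refine continuous_coinduced_dom.2 ?_
    have := hl.1
    exact (by fun_prop : Continuous (fun t => l t - t • latticeVec (displacement c)))
  refine ⟨⟨⟨fun p => linearCurve (displacement c) p.2 + proj ((p.1 : ℝ) • hper.lift p.2), ?_⟩,
    ?_, ?_⟩⟩
  · exact ((linearCurve _).continuous.comp continuous_snd).add
      (continuous_proj.comp ((continuous_subtype_val.comp continuous_fst).smul
        (hcont.comp continuous_snd)))
  · intro x
    simp [proj]
  · intro x
    induction x using QuotientAddGroup.induction_on with | _ t
    change linearCurve (displacement c) (t : UnitAddCircle) +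
      proj (((1 : I) : ℝ) • hper.lift (t : UnitAddCircle)) = c (t : UnitAddCircle)
    rw [hper.lift_coe, linearCurve_coe, ← hl.2]
    simp [proj]

theorem IsLift.add_int {l : ℝ → ℝ × ℝ} {c : C(UnitAddCircle, FlatTorus)} (hl : IsLift l c) (t : ℝ)
    (k : ℤ) : l (t + k) = l t + latticeVec (k • displacement c) := by
  induction k with
  | zero => simp [latticeVec]
  | succ k ih =>
    rw [Int.cast_add, Int.cast_one, ← add_assoc, hl.add_one, ih, add_smul, one_smul]
    simp [latticeVec, add_assoc]
  | pred k ih =>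
    have := hl.add_one (t + ((-(k : ℤ) - 1 : ℤ) : ℝ))
    rw [show t + ((-(k : ℤ) - 1 : ℤ) : ℝ) + 1 = t + ((-(k : ℤ) : ℤ) : ℝ) by push_cast; ring, ih]
      at this
    rw [← sub_eq_iff_eq_add.2 this, sub_smul, one_smul]
    simp only [latticeVec, Prod.ext_iff, Prod.fst_sub, Prod.snd_sub, Prod.fst_add, Prod.snd_add]
    push_cast
    constructor <;> ring

/-- Reparametrization by a self-map of the circle multiplies the displacement by the degree. -/
theorem exists_displacement_comp_eq (c : C(UnitAddCircle, FlatTorus))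
    (h : C(UnitAddCircle, UnitAddCircle)) : ∃ k : ℤ, displacement (c.comp h) = k • displacement c := by
  obtain ⟨l, hl⟩ := exists_isLift c
  obtain ⟨η, hη, hηh⟩ := exists_circle_lift (A := ℝ) (h.continuous.comp (AddCircle.continuous_mk' 1))
  obtain ⟨k, hk⟩ : ∃ k : ℤ, η 1 - η 0 = k := coe_unitAddCircle_eq_iff.1 (by
    rw [hηh, hηh]
    exact congrArg h (AddCircle.coe_period 1))
  refine ⟨k, IsLift.displacement_eq (l := l ∘ η) ⟨hl.1.comp hη, fun t => ?_⟩ ?_⟩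
  · rw [Function.comp_apply, hl.2, hηh]; rfl
  · rw [Function.comp_apply, Function.comp_apply, ← hl.add_int, ← hk, add_sub_cancel]

/-- The displacement modulo 2, that is, the homology class of the curve with `ℤ/2`-coefficients. -/
def displacementMod2 (c : C(UnitAddCircle, FlatTorus)) : ZMod 2 × ZMod 2 :=
  ((displacement c).1, (displacement c).2)

theorem exists_displacementMod2_comp_eq (c : C(UnitAddCircle, FlatTorus))
    (h : C(UnitAddCircle, UnitAddCircle)) :
    ∃ k : ZMod 2, displacementMod2 (c.comp h) = k • displacementMod2 c := by
  obtain ⟨k, hk⟩ := exists_displacement_comp_eq c h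
  exact ⟨k, by simp [displacementMod2, hk]⟩

/-- Two parametrizations of the same simple closed curve have the same displacement modulo 2. Each
displacement is a multiple of the other one by the degree of a reparametrization; modulo 2 the degree
is 1, or it is 0 and both displacements vanish. -/
theorem displacementMod2_eq_of_range_eq {c c' : C(UnitAddCircle, FlatTorus)}
    (hc : Function.Injective c) (hc' : Function.Injective c') (h : range c = range c') :
    displacementMod2 c = displacementMod2 c' := by
  have key : ∀ {c c' : C(UnitAddCircle, FlatTorus)}, Function.Injective c → range c = range c' →
      ∃ k : ZMod 2, displacementMod2 c' = k • displacementMod2 c := by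
    intro c c' hc h
    let e := (c.continuous.isClosedEmbedding hc).isEmbedding.toHomeomorph
    have hmem : ∀ x, c' x ∈ range c := fun x => h ▸ mem_range_self x
    let η : C(UnitAddCircle, UnitAddCircle) :=
      ⟨fun x => e.symm ⟨c' x, hmem x⟩, e.symm.continuous.comp (c'.continuous.subtype_mk hmem)⟩
    have hη : c.comp η = c' := by
      ext1 x
      exact congrArg Subtype.val (e.apply_symm_apply ⟨c' x, hmem x⟩)
    exact hη ▸ exists_displacementMod2_comp_eq c η
  obtain ⟨k, hk⟩ := key hc h
  obtain ⟨k', hk'⟩ := key hc' h.symm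
  rw [hk] at hk' ⊢
  have : k = 0 ∨ k = 1 := (by decide : ∀ k : ZMod 2, k = 0 ∨ k = 1) k
  rcases this with rfl | rfl
  · rw [hk']; simp
  · simp

end FlatTorus

namespace CellularEmbedding

open FlatTorus

variable {V E F : Type*} {G : DirMultigraph V E} (i : CellularEmbedding G F FlatTorus)

variable {i} in
/-- The value of a cocycle on a circle is a linear function of the displacement modulo 2 of the
circle. The coefficients `a` and `b` are the constants by which the potential of the cocycle changes
under the two generating translations of the plane. -/
theorem exists_displacement_pairing [Finite V] [Fintype E] [Finite F] {φ : E → ZMod 2}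
    (hφ : ∀ f, ∑ k, φ (i.walk f k).1 = 0) :
    ∃ a b : ZMod 2, ∀ (z : E → ZMod 2) (γ : C(UnitAddCircle, FlatTorus)),
      G.IsCircle (Function.support z) → i.Parametrizes γ z →
      ∑ e, z e * φ e = (displacementMod2 γ).1 * a + (displacementMod2 γ).2 * b := by
  obtain ⟨s, hs, htrans⟩ := exists_potential (i := i) (X := ℝ × ℝ) continuous_proj hφ
  obtain ⟨a, ha⟩ := htrans (· + latticeVec (1, 0)) (by fun_prop) fun x => proj_add_latticeVec x _
  obtain ⟨b, hb⟩ := htrans (· + latticeVec (0, 1)) (by fun_prop) fun x => proj_add_latticeVec x _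
  have hshift : ∀ (v : ℤ × ℤ) (c : ZMod 2), (∀ x, s (x + latticeVec v) = s x + c) →
      ∀ (m : ℤ) x, s (x + latticeVec (m • v)) = s x + m * c := by
    intro v c hc m
    induction m with
    | zero => intro x; simp [latticeVec, ← Prod.zero_eq_mk]
    | succ m ih =>
      intro x
      have h1 : x + latticeVec (((m : ℤ) + 1) • v) = x + latticeVec ((m : ℤ) • v) + latticeVec v := by
        rw [add_smul, one_smul]; simp [latticeVec, add_assoc]
      rw [h1, hc, ih]
      push_cast; ring
    | pred m ih =>
      intro x
      have h1 : x + latticeVec ((-(m : ℤ)) • v) =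
          x + latticeVec ((-(m : ℤ) - 1) • v) + latticeVec v := by
        rw [sub_smul, one_smul]
        simp [latticeVec, Prod.ext_iff]
        constructor <;> ring
      have h2 := ih x
      rw [h1, hc] at h2
      push_cast at h2 ⊢
      linear_combination h2
  refine ⟨a, b, fun z γ hz hγ => ?_⟩
  obtain ⟨γ₀, hγ₀, h₀⟩ := i.exists_parametrization hz (ℝ × ℝ)
  rw [displacementMod2_eq_of_range_eq hγ.1 hγ₀.1 (hγ.2.trans hγ₀.2.symm)]
  obtain ⟨l, hl⟩ := exists_isLift γ₀
  have h1 := h₀ proj s φ hs l hl.1 hl.2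
  have h2 := hl.add_one 0
  have h3 : l 0 + latticeVec (displacement γ₀) = l 0 +
      latticeVec ((displacement γ₀).1 • (1, 0)) + latticeVec ((displacement γ₀).2 • (0, 1)) := by
    simp [latticeVec, Prod.ext_iff]
  rw [zero_add, h3] at h2
  rw [h2, hshift _ _ hb, hshift _ _ ha] at h1
  simp only [displacementMod2]
  linear_combination -h1

/-- A chain is a boundary if all cocycles vanish on it. -/
theorem mem_boundarySpace_of_forall [Fintype E] {z : E → ZMod 2}
    (h : ∀ φ : E → ZMod 2, (∀ f, ∑ k, φ (i.walk f k).1 = 0) → ∑ e, z e * φ e = 0) :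
    z ∈ i.boundarySpace := by
  classical
  by_contra hz
  obtain ⟨Φ, hΦz, hΦ⟩ := Submodule.exists_dual_map_eq_bot_of_notMem hz inferInstance
  have hsum : ∀ w : E → ZMod 2, Φ w = ∑ e, w e * Φ (fun j => if e = j then 1 else 0) := by
    intro w
    rw [LinearMap.pi_apply_eq_sum_univ Φ w]
    rfl
  refine hΦz ((hsum z).trans (h _ fun f => ?_))
  have hf : Φ (i.faceBoundary f) = 0 := by
    have : Φ (i.faceBoundary f) ∈ Submodule.map Φ i.boundarySpace :=
      Submodule.mem_map_of_mem (Submodule.subset_span ⟨f, rfl⟩)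
    rw [hΦ] at this
    exact (Submodule.mem_bot _).1 this
  rw [hsum] at hf
  refine Eq.trans ?_ hf
  rw [← Finset.sum_fiberwise (s := Finset.univ) (g := fun k => (i.walk f k).1)]
  refine Finset.sum_congr rfl fun e _ => ?_
  rw [Finset.sum_congr rfl (fun k hk => by rw [(Finset.mem_filter.1 hk).2]), Finset.sum_const,
    nsmul_eq_mul, faceBoundary, Nat.card_eq_fintype_card, Fintype.card_subtype]

end CellularEmbedding

/-! ### Local degree of a map of the plane -/

namespace FlatTorus

open MeasureTheory

theorem proj_eq_zero_iff {x : ℝ × ℝ} : proj x = 0 ↔ ∃ A, x = latticeVec A := by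
  have h : (0 : FlatTorus) = proj 0 := rfl
  rw [h, proj_eq_proj_iff]
  simp

/-- A function that vanishes at distance at least `δ` from the integers is supported near `m` within
the unit interval around `m`. -/
theorem abs_sub_intCast_lt {b : ℝ → ℝ} {δ x : ℝ} (hb : ∀ x : ℝ, δ ≤ ‖(x : UnitAddCircle)‖ → b x = 0)
    {m : ℤ} (hx : |x - m| < 1 / 2) (hbx : b x ≠ 0) : |x - m| < δ := by
  by_contra! hcon
  refine hbx (hb x ?_)
  have h1 : (x : UnitAddCircle) = ((x - m : ℝ) : UnitAddCircle) :=
    coe_unitAddCircle_eq_iff.2 ⟨m, by ring⟩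
  have h2 := (AddCircle.norm_coe_eq_abs_iff (x := x - m) (1 : ℝ) one_ne_zero).2
    (by rw [abs_one]; exact hx.le)
  rw [h1, h2]
  exact hcon

theorem setIntegral_ball_mul (b : ℝ → ℝ) (x : ℝ × ℝ) {r : ℝ} (hr : 0 < r) :
    ∫ w in Metric.ball x r, b w.1 * b w.2 =
      (∫ t in (x.1 - r)..(x.1 + r), b t) * ∫ t in (x.2 - r)..(x.2 + r), b t := by
  rw [← ball_prod_same, Real.ball_eq_Ioo, Real.ball_eq_Ioo, Measure.volume_eq_prod,
    setIntegral_prod_mul, intervalIntegral.integral_of_le (by linarith),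
    intervalIntegral.integral_of_le (by linarith), integral_Ioc_eq_integral_Ioo,
    integral_Ioc_eq_integral_Ioo]

variable {F : ℝ × ℝ → ℝ × ℝ} {F' : ℝ × ℝ → ℝ × ℝ →L[ℝ] ℝ × ℝ}

/-- A nondegenerate point `z` over the origin of the torus is isolated among such points, and it
contributes the sign of the Jacobian to the degree: near `z`, the integral of a bump concentrated near
the lattice against the Jacobian is that sign times the integral of the bump over one period. -/
theorem exists_nhd_local_degree (hF : ∀ p, HasStrictFDerivAt F (F' p) p)
    (hJ : Continuous fun p => (F' p).det) {z : ℝ × ℝ} {A : ℤ × ℤ} (hz : F z = latticeVec A)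
    (hdet : (F' z).det ≠ 0) {N : Set (ℝ × ℝ)} (hN : N ∈ 𝓝 z) :
    ∃ U ⊆ N, IsOpen U ∧ z ∈ U ∧ (∀ p ∈ U, proj (F p) = 0 → p = z) ∧
      ∀ᶠ δ in 𝓝[>] (0 : ℝ), ∀ b : ℝ → ℝ, (∀ x : ℝ, δ ≤ ‖(x : UnitAddCircle)‖ → b x = 0) →
        ∀ C, (∀ m : ℤ, ∫ t in (m - 1 / 2 : ℝ)..(m + 1 / 2), b t = C) →
        ∫ p in U, b (F p).1 * b (F p).2 * (F' p).det = C ^ 2 * SignType.sign (F' z).det := by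
  have hFc : Continuous F := continuous_iff_continuousAt.2 fun p => (hF p).continuousAt
  let f' := (F' z).toContinuousLinearEquivOfDetNeZero hdet
  have hstrict : HasStrictFDerivAt F (f' : ℝ × ℝ →L[ℝ] ℝ × ℝ) z := by
    rw [ContinuousLinearMap.coe_toContinuousLinearEquivOfDetNeZero]; exact hF z
  let Ψ := hstrict.toOpenPartialHomeomorph F
  have hΨ : (Ψ : ℝ × ℝ → ℝ × ℝ) = F := hstrict.toOpenPartialHomeomorph_coe
  let U : Set (ℝ × ℝ) := interior N ∩ (Ψ.source ∩ (F ⁻¹' Metric.ball (F z) (1 / 2) ∩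
    {p | 0 < (F' z).det * (F' p).det}))
  have hUo : IsOpen U := isOpen_interior.inter (Ψ.open_source.inter
    ((Metric.isOpen_ball.preimage hFc).inter (isOpen_lt continuous_const
      (continuous_const.mul hJ))))
  have hzU : z ∈ U := ⟨mem_interior_iff_mem_nhds.2 hN, hstrict.mem_toOpenPartialHomeomorph_source,
    Metric.mem_ball_self (by norm_num), mul_self_pos.2 hdet⟩
  have hinj : InjOn F U := fun p hp q hq h => by
    refine Ψ.injOn hp.2.1 hq.2.1 ?_
    rw [hΨ]; exact h
  have hcoord : ∀ w ∈ Metric.ball (F z) (1 / 2), |w.1 - A.1| < 1 / 2 ∧ |w.2 - A.2| < 1 / 2 := by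
    intro w hw
    rw [Metric.mem_ball, hz, Prod.dist_eq, max_lt_iff] at hw
    exact hw
  refine ⟨U, fun p hp => interior_subset hp.1, hUo, hzU, fun p hp hp0 => ?_, ?_⟩
  · refine hinj hp hzU ?_
    obtain ⟨B, hB⟩ := proj_eq_zero_iff.1 hp0
    have h1 := hcoord _ hp.2.2.1
    rw [hB] at h1
    have h2 : ∀ m n : ℤ, |(m : ℝ) - n| < 1 / 2 → m = n := by
      intro m n h
      have : |((m - n : ℤ) : ℝ)| < 1 := by push_cast; linarith
      have h3 : |m - n| < 1 := by exact_mod_cast this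
      have := Int.abs_lt_one_iff.1 h3
      omega
    rw [hB, hz, Prod.ext (h2 _ _ h1.1) (h2 _ _ h1.2)]
  · have hmap : F '' U ∈ 𝓝 (F z) := by
      rw [← hstrict.map_nhds_eq_of_equiv]
      exact image_mem_map (hUo.mem_nhds hzU)
    obtain ⟨δ₀, hδ₀, hball⟩ := Metric.mem_nhds_iff.1 hmap
    filter_upwards [Ioo_mem_nhdsGT hδ₀] with δ hδ b hb C hC
    have hsign : ∀ p ∈ U, (F' p).det = |(F' p).det| * SignType.sign (F' z).det := by
      intro p hp
      have h1 : 0 < (F' z).det * (F' p).det := hp.2.2.2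
      rcases lt_or_gt_of_ne hdet with h | h
      · have h2 : (F' p).det < 0 := by nlinarith
        simp [sign_neg h, abs_of_neg h2]
      · have h2 : 0 < (F' p).det := by nlinarith
        simp [sign_pos h, abs_of_pos h2]
    have hsub : F '' U ⊆ Metric.ball (F z) (1 / 2) := by
      rintro _ ⟨p, hp, rfl⟩
      exact hp.2.2.1
    calc ∫ p in U, b (F p).1 * b (F p).2 * (F' p).det
        = ∫ p in U, (|(F' p).det| • (b (F p).1 * b (F p).2)) * SignType.sign (F' z).det := by
          refine setIntegral_congr_fun hUo.measurableSet fun p hp => ?_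
          simp only [smul_eq_mul]
          conv_lhs => rw [hsign p hp]
          ring
      _ = (∫ w in F '' U, b w.1 * b w.2) * SignType.sign (F' z).det := by
          rw [integral_mul_const, integral_image_eq_integral_abs_det_fderiv_smul volume
            hUo.measurableSet (fun p _ => (hF p).hasFDerivAt.hasFDerivWithinAt) hinj]
      _ = (∫ w in Metric.ball (F z) (1 / 2), b w.1 * b w.2) * SignType.sign (F' z).det := by
          congr 1
          refine (setIntegral_eq_of_subset_of_forall_sdiff_eq_zero Metric.isOpen_ball.measurableSet
            hsub fun w hw => ?_).symm
          by_contra hne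
          obtain ⟨h1, h2⟩ := hcoord w hw.1
          have h3 := abs_sub_intCast_lt hb h1 (left_ne_zero_of_mul hne)
          have h4 := abs_sub_intCast_lt hb h2 (right_ne_zero_of_mul hne)
          refine hw.2 (hball ?_)
          rw [Metric.mem_ball, hz, Prod.dist_eq, max_lt_iff]
          exact ⟨h3.trans hδ.2, h4.trans hδ.2⟩
      _ = _ := by
          rw [setIntegral_ball_mul b _ (by norm_num), hz]
          simp only [latticeVec]
          rw [hC, hC]
          ring

/-- If all points of a compact set `K` over the origin of the torus are interior and nondegenerate,
then a bump sufficiently concentrated near the lattice integrates against the Jacobian over `K` to the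
sum of the local degrees. -/
theorem eventually_integral_eq_sum_sign (hF : ∀ p, HasStrictFDerivAt F (F' p) p)
    (hJ : Continuous fun p => (F' p).det) {K : Set (ℝ × ℝ)} (hK : IsCompact K)
    {Z : Finset (ℝ × ℝ)} (hZ : ∀ p, p ∈ Z ↔ p ∈ K ∧ proj (F p) = 0)
    (hZK : ∀ p ∈ Z, K ∈ 𝓝 p) (hdet : ∀ p ∈ Z, (F' p).det ≠ 0) :
    ∀ᶠ δ in 𝓝[>] (0 : ℝ), ∀ b : ℝ → ℝ, Continuous b →
      (∀ x : ℝ, δ ≤ ‖(x : UnitAddCircle)‖ → b x = 0) →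
      ∀ C, (∀ m : ℤ, ∫ t in (m - 1 / 2 : ℝ)..(m + 1 / 2), b t = C) →
      ∫ p in K, b (F p).1 * b (F p).2 * (F' p).det =
        C ^ 2 * ∑ z ∈ Z, (SignType.sign (F' z).det : ℝ) := by
  have hFc : Continuous F := continuous_iff_continuousAt.2 fun p => (hF p).continuousAt
  obtain ⟨N, hN, hNd⟩ := Z.finite_toSet.t2_separation
  have hloc : ∀ z : ℝ × ℝ, ∃ U, z ∈ Z → U ⊆ K ∩ N z ∧ IsOpen U ∧ z ∈ U ∧
      ∀ᶠ δ in 𝓝[>] (0 : ℝ), ∀ b : ℝ → ℝ, (∀ x : ℝ, δ ≤ ‖(x : UnitAddCircle)‖ → b x = 0) →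
        ∀ C, (∀ m : ℤ, ∫ t in (m - 1 / 2 : ℝ)..(m + 1 / 2), b t = C) →
        ∫ p in U, b (F p).1 * b (F p).2 * (F' p).det = C ^ 2 * SignType.sign (F' z).det := by
    intro z
    by_cases hz : z ∈ Z
    · obtain ⟨A, hA⟩ := proj_eq_zero_iff.1 ((hZ z).1 hz).2
      obtain ⟨U, h1, h2, h3, -, h4⟩ := exists_nhd_local_degree hF hJ hA (hdet z hz)
        (inter_mem (hZK z hz) ((hN z).2.mem_nhds (hN z).1))
      exact ⟨U, fun _ => ⟨h1, h2, h3, h4⟩⟩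
    · exact ⟨∅, fun h => absurd h hz⟩
  choose U hU using hloc
  have hUo : IsOpen (⋃ z ∈ Z, U z) := isOpen_biUnion fun z hz => (hU z hz).2.1
  obtain ⟨δ₁, hδ₁, hfar⟩ : ∃ δ₁ > 0, ∀ p ∈ K \ ⋃ z ∈ Z, U z, δ₁ ≤ ‖proj (F p)‖ := by
    have hc : IsCompact (K \ ⋃ z ∈ Z, U z) := hK.diff hUo
    rcases (K \ ⋃ z ∈ Z, U z).eq_empty_or_nonempty with he | hne
    · exact ⟨1, one_pos, fun p hp => by simp [he] at hp⟩
    · obtain ⟨p₀, hp₀, hmin⟩ := hc.exists_isMinOn hne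
        (continuous_norm.comp (continuous_proj.comp hFc)).continuousOn
      refine ⟨‖proj (F p₀)‖, norm_pos_iff.2 fun h => ?_, fun p hp => hmin hp⟩
      have hz := (hZ p₀).2 ⟨hp₀.1, h⟩
      exact hp₀.2 (mem_biUnion hz (hU p₀ hz).2.2.1)
  -- `δ` is small enough for the local formulas, and so small that the integrand vanishes elsewhere.
  have hall := (Filter.eventually_all_finset Z).2 fun z hz => (hU z hz).2.2.2
  filter_upwards [hall, Ioo_mem_nhdsGT hδ₁] with δ hδ hδ1 b hbc hb C hC
  have hsub : ⋃ z ∈ Z, U z ⊆ K := iUnion₂_subset fun z hz => (hU z hz).1.trans inter_subset_left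
  have hint : IntegrableOn (fun p => b (F p).1 * b (F p).2 * (F' p).det) K := by
    refine ContinuousOn.integrableOn_compact hK ?_
    fun_prop
  rw [setIntegral_eq_of_subset_of_forall_sdiff_eq_zero hK.measurableSet hsub fun p hp => ?_,
    integral_biUnion_finset Z (fun z hz => (hU z hz).2.1.measurableSet) ?_
      (fun z hz => hint.mono_set ((hU z hz).1.trans inter_subset_left)), Finset.mul_sum]
  · exact Finset.sum_congr rfl fun z hz => hδ z hz b hb C hC
  · exact fun z hz z' hz' hne => (hNd hz hz' hne).mono ((hU z hz).1.trans inter_subset_right)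
      ((hU z' hz').1.trans inter_subset_right)
  · have h1 := hfar p hp
    rw [Prod.norm_def, le_max_iff] at h1
    rcases h1 with h1 | h1
    · rw [hb _ (hδ1.2.le.trans h1)]; ring
    · rw [hb _ (hδ1.2.le.trans h1)]; ring

end FlatTorus

/-! ### The integral of a periodic bump against the Jacobian -/

namespace FlatTorus

open MeasureTheory

/-- There are periodic bumps `b` with positive integral `C` over a period and with support arbitrarily
close to the integers; `B` is a primitive of `b`. -/
theorem exists_periodic_bump {δ : ℝ} (h0 : 0 < δ) (h1 : δ < 1 / 2) :
    ∃ (b B : ℝ → ℝ) (C : ℝ), 0 < C ∧ Differentiable ℝ b ∧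
      (∀ x, HasDerivAt B (b x) x) ∧ Function.Periodic b 1 ∧ (∀ x, B (x + 1) = B x + C) ∧
      ∀ x : ℝ, δ ≤ ‖(x : UnitAddCircle)‖ → b x = 0 := by
  let κ := Real.cos (2 * Real.pi * δ)
  -- This is positive where `cos (2 π x) > κ`, that is, at distance less than `δ` from the integers.
  let b : ℝ → ℝ := fun x => Real.smoothTransition (Real.cos (2 * Real.pi * x) - κ)
  have hb : ContDiff ℝ 1 b := Real.smoothTransition.contDiff.comp (by fun_prop)
  have hper : Function.Periodic b 1 := fun x => by
    simp only [b, mul_add, mul_one, Real.cos_add_two_pi]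
  have hpi := Real.pi_pos
  have hint : ∀ u v, IntervalIntegrable b volume u v := fun u v => hb.continuous.intervalIntegrable u v
  refine ⟨b, fun x => ∫ t in (0 : ℝ)..x, b t, ∫ t in (0 : ℝ)..1, b t, ?_,
    hb.differentiable one_ne_zero, fun x => ?_, hper, fun x => ?_, fun x hx => ?_⟩
  · refine intervalIntegral.integral_pos one_pos hb.continuous.continuousOn
      (fun x _ => Real.smoothTransition.nonneg _) ⟨0, by simp, ?_⟩
    refine Real.smoothTransition.pos_of_pos ?_
    rw [mul_zero, sub_pos]
    exact Real.cos_lt_cos_of_nonneg_of_le_pi le_rfl (by nlinarith) (by positivity)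
  · exact (hb.continuous.integral_hasStrictDerivAt 0 x).hasDerivAt
  · have h := hper.intervalIntegral_add_eq x 0
    rw [zero_add] at h
    rw [← h, intervalIntegral.integral_add_adjacent_intervals (hint _ _) (hint _ _)]
  · refine Real.smoothTransition.zero_of_nonpos (sub_nonpos.2 ?_)
    rw [UnitAddCircle.norm_eq] at hx
    have h2 : Real.cos (2 * Real.pi * x) = Real.cos (2 * Real.pi * |x - round x|) := by
      rw [show 2 * Real.pi * |x - round x| = |2 * Real.pi * (x - round x)| by
        rw [abs_mul, abs_of_pos (by positivity : 0 < 2 * Real.pi)], Real.cos_abs,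
        show 2 * Real.pi * (x - round x) = 2 * Real.pi * x - round x * (2 * Real.pi) by ring,
        Real.cos_sub_int_mul_two_pi]
    rw [h2]
    have h3 := abs_sub_round x
    exact Real.cos_le_cos_of_nonneg_of_le_pi (by positivity) (by nlinarith) (by nlinarith)

variable {l₁ l₂ l₁' l₂' : ℝ → ℝ × ℝ}

/-- The derivative of the map `(s, t) ↦ l₁ s - l₂ t`, in terms of the derivatives of `l₁` and `l₂`. -/
def diffFDeriv (l₁' l₂' : ℝ → ℝ × ℝ) (p : ℝ × ℝ) : ℝ × ℝ →L[ℝ] ℝ × ℝ :=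
  (ContinuousLinearMap.fst ℝ ℝ ℝ).smulRight (l₁' p.1) -
    (ContinuousLinearMap.snd ℝ ℝ ℝ).smulRight (l₂' p.2)

theorem det_diffFDeriv (p : ℝ × ℝ) : (diffFDeriv l₁' l₂' p).det =
    (l₂' p.2).1 * (l₁' p.1).2 - (l₁' p.1).1 * (l₂' p.2).2 := by
  have h : diffFDeriv l₁' l₂' p = LinearMap.toContinuousLinearMap
      (Matrix.toLin (Module.Basis.finTwoProd ℝ) (Module.Basis.finTwoProd ℝ)
        !![(l₁' p.1).1, -(l₂' p.2).1; (l₁' p.1).2, -(l₂' p.2).2]) := by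
    rw [Matrix.toLin_finTwoProd_toContinuousLinearMap]
    ext <;> simp [diffFDeriv]
  rw [h, LinearMap.det_toContinuousLinearMap, LinearMap.det_toLin, Matrix.det_fin_two_of]
  ring

theorem hasStrictFDerivAt_diff (h₁ : ContDiff ℝ ∞ l₁) (h₂ : ContDiff ℝ ∞ l₂) (p : ℝ × ℝ) :
    HasStrictFDerivAt (fun p : ℝ × ℝ => l₁ p.1 - l₂ p.2) (diffFDeriv (deriv l₁) (deriv l₂) p) p := by
  have d₁ : HasStrictDerivAt l₁ (deriv l₁ p.1) p.1 := h₁.contDiffAt.hasStrictDerivAt (by simp)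
  have d₂ : HasStrictDerivAt l₂ (deriv l₂ p.2) p.2 := h₂.contDiffAt.hasStrictDerivAt (by simp)
  have := (d₁.hasStrictFDerivAt.comp p hasStrictFDerivAt_fst).sub
    (d₂.hasStrictFDerivAt.comp p hasStrictFDerivAt_snd)
  refine this.congr_fderiv ?_
  ext <;> simp [diffFDeriv]

theorem continuous_det_diffFDeriv (h₁ : ContDiff ℝ ∞ l₁) (h₂ : ContDiff ℝ ∞ l₂) :
    Continuous fun p => (diffFDeriv (deriv l₁) (deriv l₂) p).det := by
  have hc₁ : Continuous (deriv l₁) := h₁.continuous_deriv (by simp)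
  have hc₂ : Continuous (deriv l₂) := h₂.continuous_deriv (by simp)
  simp only [det_diffFDeriv]
  fun_prop

/-- The degree of `(s, t) ↦ l₁ s - l₂ t` computed from the periods. With `x` and `y` the components of
this map, the integrand `b(x) b(y) det` is the divergence of `B(x) b(y) (∂y/∂t, -∂y/∂s)`, so the
integral over a fundamental square is a boundary term, and there the values on opposite sides differ
only through the displacements. -/
theorem integral_square_bump_mul_det (h₁ : ContDiff ℝ ∞ l₁) (h₂ : ContDiff ℝ ∞ l₂)
    {A₁ A₂ : ℤ × ℤ} (hA₁ : ∀ t, l₁ (t + 1) = l₁ t + latticeVec A₁)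
    (hA₂ : ∀ t, l₂ (t + 1) = l₂ t + latticeVec A₂) {b B : ℝ → ℝ} {C : ℝ}
    (hbd : Differentiable ℝ b) (hB : ∀ x, HasDerivAt B (b x) x)
    (hper : Function.Periodic b 1) (hBper : ∀ x, B (x + 1) = B x + C) (s₀ t₀ : ℝ) :
    ∫ p in Icc (s₀, t₀) (s₀ + 1, t₀ + 1), b (l₁ p.1 - l₂ p.2).1 * b (l₁ p.1 - l₂ p.2).2 *
      (diffFDeriv (deriv l₁) (deriv l₂) p).det =
        C ^ 2 * ((A₁.2 * A₂.1 - A₁.1 * A₂.2 : ℤ) : ℝ) := by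
  have hBd : Differentiable ℝ B := fun x => (hB x).differentiableAt
  have hd₁ : Differentiable ℝ l₁ := h₁.differentiable (by simp)
  have hd₂ : Differentiable ℝ l₂ := h₂.differentiable (by simp)
  have hd₁' : Differentiable ℝ (deriv l₁) :=
    (contDiff_infty_iff_deriv.1 h₁).2.differentiable (by simp)
  have hd₂' : Differentiable ℝ (deriv l₂) :=
    (contDiff_infty_iff_deriv.1 h₂).2.differentiable (by simp)
  have hbc := hbd.continuous
  have hBc := hBd.continuous
  have hc₁ := hd₁.continuous
  have hc₂ := hd₂.continuous
  have hc₁' := hd₁'.continuous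
  have hc₂' := hd₂'.continuous
  have dx₁ : ∀ s, HasDerivAt (fun s => (l₁ s).1) (deriv l₁ s).1 s := fun s =>
    (hd₁ s).hasDerivAt.fst
  have dy₁ : ∀ s, HasDerivAt (fun s => (l₁ s).2) (deriv l₁ s).2 s := fun s =>
    (hd₁ s).hasDerivAt.snd
  have dx₂ : ∀ s, HasDerivAt (fun s => (l₂ s).1) (deriv l₂ s).1 s := fun s =>
    (hd₂ s).hasDerivAt.fst
  have dy₂ : ∀ s, HasDerivAt (fun s => (l₂ s).2) (deriv l₂ s).2 s := fun s =>
    (hd₂ s).hasDerivAt.snd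
  let f : ℝ × ℝ → ℝ := fun p => B ((l₁ p.1).1 - (l₂ p.2).1) * b ((l₁ p.1).2 - (l₂ p.2).2) *
    -(deriv l₂ p.2).2
  let g : ℝ × ℝ → ℝ := fun p => B ((l₁ p.1).1 - (l₂ p.2).1) * b ((l₁ p.1).2 - (l₂ p.2).2) *
    -(deriv l₁ p.1).2
  have hf : Differentiable ℝ f := by
    unfold f; fun_prop
  have hg : Differentiable ℝ g := by
    unfold g; fun_prop
  have hdiv : ∀ p, fderiv ℝ f p (1, 0) + fderiv ℝ g p (0, 1) =
      b (l₁ p.1 - l₂ p.2).1 * b (l₁ p.1 - l₂ p.2).2 *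
      (diffFDeriv (deriv l₁) (deriv l₂) p).det := by
    rintro ⟨s, t⟩
    have e1 : HasDerivAt (fun s => f (s, t)) (fderiv ℝ f (s, t) (1, 0)) s :=
      HasFDerivAt.comp_hasDerivAt (f := fun s => (s, t)) s (hf (s, t)).hasFDerivAt
        ((hasDerivAt_id s).prodMk (hasDerivAt_const s t))
    have e2 : HasDerivAt (fun t => g (s, t)) (fderiv ℝ g (s, t) (0, 1)) t :=
      HasFDerivAt.comp_hasDerivAt (f := fun t => (s, t)) t (hg (s, t)).hasFDerivAt
        ((hasDerivAt_const t s).prodMk (hasDerivAt_id t))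
    have e1' := ((((hB _).comp s ((dx₁ s).sub_const (l₂ t).1)).mul
      ((hbd _).hasDerivAt.comp s ((dy₁ s).sub_const (l₂ t).2))).mul_const (-(deriv l₂ t).2))
    have e2' := ((((hB _).comp t ((dx₂ t).const_sub (l₁ s).1)).mul
      ((hbd _).hasDerivAt.comp t ((dy₂ t).const_sub (l₁ s).2))).mul_const (-(deriv l₁ s).2))
    rw [e1.unique e1', e2.unique e2', det_diffFDeriv]
    simp only [Function.comp_apply, Prod.fst_sub, Prod.snd_sub]
    ring
  have hint : IntegrableOn (fun p => fderiv ℝ f p (1, 0) + fderiv ℝ g p (0, 1))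
      (Icc (s₀, t₀) (s₀ + 1, t₀ + 1)) := by
    refine ContinuousOn.integrableOn_compact isCompact_Icc ?_
    simp only [hdiv, det_diffFDeriv]
    fun_prop
  have key := integral_divergence_prod_Icc_of_hasFDerivAt_off_countable_of_le f g (fderiv ℝ f)
    (fderiv ℝ g) (s₀, t₀) (s₀ + 1, t₀ + 1) ⟨by simp, by simp⟩ ∅ countable_empty
    hf.continuous.continuousOn hg.continuous.continuousOn
    (fun p _ => (hf p).hasFDerivAt) (fun p _ => (hg p).hasFDerivAt) hint
  simp only [hdiv] at key
  rw [key]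
  have hBsub : ∀ (x : ℝ) (m : ℤ), B (x + m) = B x + m * C := by
    intro x m
    induction m with
    | zero => simp
    | succ m ih =>
      push_cast at ih ⊢
      rw [← add_assoc, hBper, ih]; ring
    | pred m ih =>
      have := hBper (x + ((-(m : ℤ) - 1 : ℤ) : ℝ))
      rw [show x + ((-(m : ℤ) - 1 : ℤ) : ℝ) + 1 = x + ((-(m : ℤ) : ℤ) : ℝ) by push_cast; ring, ih]
        at this
      push_cast at this ⊢
      linarith
  have hbsub : ∀ (x : ℝ) (m : ℤ), b (x + m) = b x := fun x m => by
    simpa using hper.int_mul m x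
  have hgcont := hg.continuous
  have hfcont := hf.continuous
  have hgi : (∫ s in s₀..s₀ + 1, g (s, t₀ + 1)) - ∫ s in s₀..s₀ + 1, g (s, t₀) =
      A₂.1 * C * (A₁.2 * C) := by
    rw [← intervalIntegral.integral_sub (Continuous.intervalIntegrable (by fun_prop) _ _)
      (Continuous.intervalIntegrable (by fun_prop) _ _)]
    have h : ∀ s, g (s, t₀ + 1) - g (s, t₀) =
        A₂.1 * C * (b ((l₁ s).2 - (l₂ t₀).2) * (deriv l₁ s).2) := by
      intro s
      have e1 : (l₁ s).1 - (l₂ (t₀ + 1)).1 = (l₁ s).1 - (l₂ t₀).1 + (-A₂.1 : ℤ) := by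
        rw [hA₂]; simp [latticeVec]; ring
      have e2 : (l₁ s).2 - (l₂ (t₀ + 1)).2 = (l₁ s).2 - (l₂ t₀).2 + (-A₂.2 : ℤ) := by
        rw [hA₂]; simp [latticeVec]; ring
      simp only [g, e1, e2, hBsub, hbsub]
      push_cast
      ring
    simp only [h]
    rw [intervalIntegral.integral_const_mul,
      intervalIntegral.integral_eq_sub_of_hasDerivAt
        (f := fun s => B ((l₁ s).2 - (l₂ t₀).2))
        (fun s _ => (hB _).comp s ((dy₁ s).sub_const (l₂ t₀).2))
        (Continuous.intervalIntegrable (by fun_prop) _ _)]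
    have e3 : (l₁ (s₀ + 1)).2 - (l₂ t₀).2 = (l₁ s₀).2 - (l₂ t₀).2 + A₁.2 := by
      rw [hA₁]; simp [latticeVec]; ring
    rw [e3, hBsub]
    ring
  have hfi : (∫ t in t₀..t₀ + 1, f (s₀ + 1, t)) - ∫ t in t₀..t₀ + 1, f (s₀, t) =
      A₁.1 * C * (-A₂.2 * C) := by
    rw [← intervalIntegral.integral_sub (Continuous.intervalIntegrable (by fun_prop) _ _)
      (Continuous.intervalIntegrable (by fun_prop) _ _)]
    have h : ∀ t, f (s₀ + 1, t) - f (s₀, t) =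
        A₁.1 * C * (b ((l₁ s₀).2 - (l₂ t).2) * -(deriv l₂ t).2) := by
      intro t
      have e1 : (l₁ (s₀ + 1)).1 - (l₂ t).1 = (l₁ s₀).1 - (l₂ t).1 + A₁.1 := by
        rw [hA₁]; simp [latticeVec]; ring
      have e2 : (l₁ (s₀ + 1)).2 - (l₂ t).2 = (l₁ s₀).2 - (l₂ t).2 + A₁.2 := by
        rw [hA₁]; simp [latticeVec]; ring
      simp only [f, e1, e2, hBsub, hbsub]
      ring
    simp only [h]
    rw [intervalIntegral.integral_const_mul,
      intervalIntegral.integral_eq_sub_of_hasDerivAt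
        (f := fun t => B ((l₁ s₀).2 - (l₂ t).2))
        (fun t _ => (hB _).comp t ((dy₂ t).const_sub (l₁ s₀).2))
        (Continuous.intervalIntegrable (by fun_prop) _ _)]
    have e3 : (l₁ s₀).2 - (l₂ (t₀ + 1)).2 = (l₁ s₀).2 - (l₂ t₀).2 + (-A₂.2 : ℤ) := by
      rw [hA₂]; simp [latticeVec]; ring
    rw [e3, hBsub]
    push_cast
    ring
  rw [hgi, add_sub_assoc, hfi]
  push_cast
  ring

end FlatTorus

/-! ### Counting crossings -/

namespace FlatTorus

open MeasureTheory

theorem IsSmoothLift.isLift {l : ℝ → ℝ × ℝ} {c : C(UnitAddCircle, FlatTorus)}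
    (h : IsSmoothLift l c) : IsLift l c :=
  ⟨h.1.continuous, fun t => (h.2 t).symm⟩

theorem det_ne_zero_of_linearIndependent {u v : ℝ × ℝ} (h : LinearIndependent ℝ ![u, v]) :
    v.1 * u.2 - u.1 * v.2 ≠ 0 := by
  intro h0
  rw [LinearIndependent.pair_iff] at h
  have h1 := h v.2 (-u.2) (Prod.ext (by simp; linarith) (by simp; ring))
  have h2 := h v.1 (-u.1) (Prod.ext (by simp; ring) (by simp; linarith))
  have h3 := h 1 0 (Prod.ext (by simpa using h2.2) (by simpa using h1.2))
  exact one_ne_zero h3.1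

theorem linearIndependent_of_det_ne_zero {u v : ℝ × ℝ} (h : v.1 * u.2 - u.1 * v.2 ≠ 0) :
    LinearIndependent ℝ ![u, v] := by
  rw [LinearIndependent.pair_iff]
  intro a b hab
  have h1 : a * u.1 + b * v.1 = 0 := congrArg Prod.fst hab
  have h2 : a * u.2 + b * v.2 = 0 := congrArg Prod.snd hab
  constructor
  · refine (mul_eq_zero.1 (?_ : a * (v.1 * u.2 - u.1 * v.2) = 0)).resolve_right h
    linear_combination v.1 * h2 - v.2 * h1
  · refine (mul_eq_zero.1 (?_ : b * (v.1 * u.2 - u.1 * v.2) = 0)).resolve_right h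
    linear_combination u.2 * h1 - u.1 * h2

theorem infinite_unitAddCircle : Infinite UnitAddCircle :=
  have : Infinite (Ico (0 : ℝ) (0 + 1)) := (Ico_infinite (by norm_num)).to_subtype
  Infinite.of_injective _ (AddCircle.equivIco (1 : ℝ) 0).symm.injective

theorem proj_sub_eq_zero_iff {c₁ c₂ : C(UnitAddCircle, FlatTorus)} {l₁ l₂ : ℝ → ℝ × ℝ}
    (h₁ : IsLift l₁ c₁) (h₂ : IsLift l₂ c₂) {s t : ℝ} :
    proj (l₁ s - l₂ t) = 0 ↔ c₁ (s : UnitAddCircle) = c₂ (t : UnitAddCircle) := by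
  rw [← h₁.2, ← h₂.2]
  change proj (l₁ s) - proj (l₂ t) = 0 ↔ _
  exact sub_eq_zero

theorem exists_coe_eq_mem_Ico (s₀ : ℝ) (x : UnitAddCircle) :
    ∃ s ∈ Ico s₀ (s₀ + 1), (s : UnitAddCircle) = x :=
  ⟨_, (AddCircle.equivIco 1 s₀ x).2, AddCircle.coe_equivIco⟩

theorem finite_crossings {c₁ c₂ : C(UnitAddCircle, FlatTorus)} (h : GeneralPosition c₁ c₂) :
    (crossings c₁ c₂).Finite := by
  obtain ⟨l₁, l₂, h₁, h₂, htr⟩ := h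
  let F : ℝ × ℝ → ℝ × ℝ := fun p => l₁ p.1 - l₂ p.2
  have hc₁ := h₁.1.continuous
  have hc₂ := h₂.1.continuous
  have hF : ∀ p, HasStrictFDerivAt F (diffFDeriv (deriv l₁) (deriv l₂) p) p := fun p =>
    hasStrictFDerivAt_diff h₁.1 h₂.1 p
  have hJ := continuous_det_diffFDeriv h₁.1 h₂.1
  have hFc : Continuous fun p => proj (F p) := continuous_proj.comp (by fun_prop)
  have hfin : {p : ℝ × ℝ | p ∈ Icc ((0, 0) : ℝ × ℝ) (1, 1) ∧ proj (F p) = 0}.Finite := by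
    by_contra hinf
    obtain ⟨p, -, hp⟩ := Set.Infinite.exists_accPt_of_subset_isCompact hinf isCompact_Icc
      (fun p hp => hp.1)
    rw [accPt_iff_frequently] at hp
    have hp0 : proj (F p) = 0 :=
      (isClosed_eq hFc continuous_const).mem_of_frequently_of_tendsto
        (hp.mono fun q hq => hq.2.2) tendsto_id
    obtain ⟨A, hA⟩ := proj_eq_zero_iff.1 hp0
    have hdet : (diffFDeriv (deriv l₁) (deriv l₂) p).det ≠ 0 := by
      rw [det_diffFDeriv]
      exact det_ne_zero_of_linearIndependent
        (htr _ _ ((proj_sub_eq_zero_iff h₁.isLift h₂.isLift).1 hp0))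
    obtain ⟨U, -, hUo, hpU, hU, -⟩ := exists_nhd_local_degree hF hJ hA hdet univ_mem
    obtain ⟨q, ⟨hqp, hq⟩, hqU⟩ := (hp.and_eventually (hUo.mem_nhds hpU)).exists
    exact hqp (hU q hqU hq.2)
  refine (hfin.image fun p => ((p.1 : UnitAddCircle), (p.2 : UnitAddCircle))).subset ?_
  rintro ⟨x, y⟩ hxy
  obtain ⟨s, hs, rfl⟩ := exists_coe_eq_mem_Ico 0 x
  obtain ⟨t, ht, rfl⟩ := exists_coe_eq_mem_Ico 0 y
  rw [zero_add] at hs ht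
  exact ⟨(s, t), ⟨⟨⟨hs.1, ht.1⟩, hs.2.le, ht.2.le⟩,
    (proj_sub_eq_zero_iff h₁.isLift h₂.isLift).2 hxy⟩, rfl⟩

/-- The number of crossings of two closed curves in general position is, modulo 2, the determinant of
their displacements: the crossings are the points over the origin of the map `(s, t) ↦ l₁ s - l₂ t`,
all of them nondegenerate, and the number of these has the parity of the degree. -/
theorem ncard_crossings {c₁ c₂ : C(UnitAddCircle, FlatTorus)} (h : GeneralPosition c₁ c₂) :
    ((crossings c₁ c₂).ncard : ZMod 2) =
      (displacementMod2 c₁).2 * (displacementMod2 c₂).1 -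
        (displacementMod2 c₁).1 * (displacementMod2 c₂).2 := by
  classical
  have hK := finite_crossings h
  obtain ⟨l₁, l₂, h₁, h₂, htr⟩ := h
  let F : ℝ × ℝ → ℝ × ℝ := fun p => l₁ p.1 - l₂ p.2
  have hF : ∀ p, HasStrictFDerivAt F (diffFDeriv (deriv l₁) (deriv l₂) p) p := fun p =>
    hasStrictFDerivAt_diff h₁.1 h₂.1 p
  have hJ := continuous_det_diffFDeriv h₁.1 h₂.1
  have hzero : ∀ p : ℝ × ℝ, proj (F p) = 0 ↔
      ((p.1 : UnitAddCircle), (p.2 : UnitAddCircle)) ∈ crossings c₁ c₂ := fun p =>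
    proj_sub_eq_zero_iff h₁.isLift h₂.isLift
  -- The fundamental square is placed so that no crossing lies on its boundary.
  have := infinite_unitAddCircle
  obtain ⟨x₀, hx₀⟩ := (hK.image Prod.fst).exists_notMem
  obtain ⟨y₀, hy₀⟩ := (hK.image Prod.snd).exists_notMem
  obtain ⟨s₀, -, rfl⟩ := exists_coe_eq_mem_Ico 0 x₀
  obtain ⟨t₀, -, rfl⟩ := exists_coe_eq_mem_Ico 0 y₀
  let Q : Set (ℝ × ℝ) := Icc (s₀, t₀) (s₀ + 1, t₀ + 1)
  let q : ℝ × ℝ → UnitAddCircle × UnitAddCircle := fun p => (p.1, p.2)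
  have hinner : ∀ (a₀ a : ℝ), a₀ ≤ a → a ≤ a₀ + 1 → (a : UnitAddCircle) ≠ a₀ →
      a ∈ Ioo a₀ (a₀ + 1) := by
    intro a₀ a h0 h1 hne
    refine ⟨lt_of_le_of_ne h0 ?_, lt_of_le_of_ne h1 ?_⟩
    · rintro rfl; exact hne rfl
    · rintro rfl; exact hne (AddCircle.coe_add_period 1 a₀)
  have hIoo : ∀ p ∈ Q ∩ {p | proj (F p) = 0}, p ∈ Ioo s₀ (s₀ + 1) ×ˢ Ioo t₀ (t₀ + 1) := by
    rintro p ⟨⟨hp1, hp2⟩, hp0⟩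
    have hpc := (hzero p).1 hp0
    exact ⟨hinner _ _ hp1.1 hp2.1 fun h => hx₀ ⟨_, hpc, h⟩,
      hinner _ _ hp1.2 hp2.2 fun h => hy₀ ⟨_, hpc, h⟩⟩
  have hinj : InjOn q (Q ∩ {p | proj (F p) = 0}) := by
    intro p hp p' hp' hpp
    have h1 := hIoo p hp
    have h2 := hIoo p' hp'
    exact Prod.ext
      ((AddCircle.coe_eq_coe_iff_of_mem_Ico (Ioo_subset_Ico_self h1.1)
        (Ioo_subset_Ico_self h2.1)).1 (congrArg Prod.fst hpp))
      ((AddCircle.coe_eq_coe_iff_of_mem_Ico (Ioo_subset_Ico_self h1.2)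
        (Ioo_subset_Ico_self h2.2)).1 (congrArg Prod.snd hpp))
  have himg : q '' (Q ∩ {p | proj (F p) = 0}) = crossings c₁ c₂ := by
    apply Subset.antisymm
    · rintro _ ⟨p, hp, rfl⟩
      exact (hzero p).1 hp.2
    · rintro ⟨x, y⟩ hxy
      obtain ⟨s, hs, rfl⟩ := exists_coe_eq_mem_Ico s₀ x
      obtain ⟨t, ht, rfl⟩ := exists_coe_eq_mem_Ico t₀ y
      exact ⟨(s, t), ⟨⟨⟨hs.1, ht.1⟩, hs.2.le, ht.2.le⟩, (hzero (s, t)).2 hxy⟩, rfl⟩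
  have hfin : (Q ∩ {p | proj (F p) = 0}).Finite := Finite.of_finite_image (himg ▸ hK) hinj
  let Z := hfin.toFinset
  have hZ : ∀ p, p ∈ Z ↔ p ∈ Q ∧ proj (F p) = 0 := fun p => hfin.mem_toFinset
  have hcard : (crossings c₁ c₂).ncard = Z.card := by
    rw [← himg, hinj.ncard_image, ncard_eq_toFinset_card _ hfin]
  have hdet : ∀ p ∈ Z, (diffFDeriv (deriv l₁) (deriv l₂) p).det ≠ 0 := by
    intro p hp
    rw [det_diffFDeriv]
    exact det_ne_zero_of_linearIndependent (htr _ _ ((hzero p).1 ((hZ p).1 hp).2))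
  have hnhds : ∀ p ∈ Z, Q ∈ 𝓝 p := by
    intro p hp
    have h1 := hIoo p ((hZ p).1 hp)
    refine mem_of_superset ((isOpen_Ioo.prod isOpen_Ioo).mem_nhds h1) ?_
    exact fun w hw => ⟨⟨hw.1.1.le, hw.2.1.le⟩, hw.1.2.le, hw.2.2.le⟩
  obtain ⟨δ, hδ, hδ0, hδ1⟩ := ((eventually_integral_eq_sum_sign hF hJ isCompact_Icc hZ hnhds
    hdet).and (Ioo_mem_nhdsGT (by norm_num : (0 : ℝ) < 1 / 2))).exists
  obtain ⟨b, B, C, hC, hb, hB, hper, hBper, hvan⟩ := exists_periodic_bump hδ0 hδ1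
  have hbc := hb.continuous
  have e1 := hδ b hbc hvan C fun m => by
    rw [intervalIntegral.integral_eq_sub_of_hasDerivAt (fun x _ => hB x)
      (hbc.intervalIntegrable _ _)]
    have := hBper (m - 1 / 2)
    rw [show (m - 1 / 2 + 1 : ℝ) = m + 1 / 2 by ring] at this
    rw [this]; ring
  have e2 := integral_square_bump_mul_det h₁.1 h₂.1 h₁.isLift.add_one h₂.isLift.add_one hb hB hper
    hBper s₀ t₀
  have e3 := mul_left_cancel₀ (pow_ne_zero 2 hC.ne') (e1.symm.trans e2)
  have e4 : ∑ z ∈ Z, ((SignType.sign (diffFDeriv (deriv l₁) (deriv l₂) z).det : SignType) : ℤ) =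
      (displacement c₁).2 * (displacement c₂).1 - (displacement c₁).1 * (displacement c₂).2 := by
    have : ∀ ε : SignType, ((ε : ℤ) : ℝ) = (ε : ℝ) := fun ε => by cases ε <;> simp
    rw [← Int.cast_inj (α := ℝ), ← e3, Int.cast_sum]
    exact Finset.sum_congr rfl fun z _ => this _
  have e5 := congrArg (Int.cast : ℤ → ZMod 2) e4
  rw [Int.cast_sum, Finset.sum_congr rfl (g := fun _ => 1) fun z hz => ?_] at e5
  · rw [hcard]
    simp only [displacementMod2]
    push_cast at e5
    simpa using e5
  · have : ∀ ε : SignType, ε ≠ 0 → ((ε : ℤ) : ZMod 2) = 1 := by decide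
    exact this _ (sign_ne_zero.2 (hdet z hz))

theorem hasIntersectionIndex_one {γ₁ γ₂ : C(UnitAddCircle, FlatTorus)}
    (h : (displacementMod2 γ₁).2 * (displacementMod2 γ₂).1 -
        (displacementMod2 γ₁).1 * (displacementMod2 γ₂).2 = 1) :
    HasIntersectionIndex γ₁ γ₂ 1 := by
  refine ⟨⟨_, _, linearCurve_homotopic γ₁, linearCurve_homotopic γ₂, ?_⟩, ?_⟩
  · have hsm : ∀ A, IsSmoothLift (fun t : ℝ => t • latticeVec A) (linearCurve A) := fun A =>
      ⟨by fun_prop, linearCurve_coe A⟩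
    have hder : ∀ A t, deriv (fun t : ℝ => t • latticeVec A) t = latticeVec A := fun A t => by
      simpa using ((hasDerivAt_id t).smul_const (latticeVec A)).deriv
    refine ⟨_, _, hsm _, hsm _, fun s t _ => ?_⟩
    rw [hder, hder]
    refine linearIndependent_of_det_ne_zero fun h0 => ?_
    have h1 : (displacement γ₂).1 * (displacement γ₁).2 -
        (displacement γ₁).1 * (displacement γ₂).2 = 0 := by
      have h2 : (((displacement γ₂).1 * (displacement γ₁).2 -
        (displacement γ₁).1 * (displacement γ₂).2 : ℤ) : ℝ) = 0 := by
        push_cast; exact h0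
      exact_mod_cast h2
    have h2 := congrArg (Int.cast : ℤ → ZMod 2) h1
    push_cast at h2
    simp only [displacementMod2] at h
    rw [mul_comm] at h2
    rw [h2] at h
    exact zero_ne_one h
  · intro c₁ c₂ hc₁ hc₂ hgp
    refine ⟨finite_crossings hgp, ?_⟩
    rw [ncard_crossings hgp, ← h]
    simp only [displacementMod2, displacement_eq_of_homotopic hc₁,
      displacement_eq_of_homotopic hc₂]

end FlatTorus

end

theorem lemma2p4 {V E F : Type*} [Finite V] [Finite E] [Finite F]
    (G : DirMultigraph V E) (hG : G.Connected)
    (i : CellularEmbedding G F FlatTorus)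
    (z₁ z₂ : G.cycleSpace)
    (hc₁ : G.IsCircle (Function.support (z₁ : E → ZMod 2)))
    (hc₂ : G.IsCircle (Function.support (z₂ : E → ZMod 2)))
    (h₁ : i.homologyClass z₁ ≠ 0)
    (h₂ : i.homologyClass z₂ ≠ 0)
    (h₁₂ : i.homologyClass z₁ ≠ i.homologyClass z₂) :
    i.HasIntersectionIndex (z₁ : E → ZMod 2) (z₂ : E → ZMod 2) 1 := by
  cases nonempty_fintype E
  have hmem : ∀ z : G.cycleSpace, (z : E → ZMod 2) ∈ i.boundarySpace → i.homologyClass z = 0 :=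
    fun z hz => (Submodule.Quotient.mk_eq_zero _).2 hz
  obtain ⟨γ₁', hγ₁', -⟩ := i.exists_parametrization hc₁ ℝ
  obtain ⟨γ₂', hγ₂', -⟩ := i.exists_parametrization hc₂ ℝ
  refine ⟨⟨γ₁', γ₂', hγ₁', hγ₂'⟩, fun γ₁ γ₂ hγ₁ hγ₂ => FlatTorus.hasIntersectionIndex_one ?_⟩
  have key₁ : FlatTorus.displacementMod2 γ₁ ≠ 0 := fun h0 =>
    h₁ (hmem _ (i.mem_boundarySpace_of_forall fun φ hφ => by
      obtain ⟨a, b, hab⟩ := CellularEmbedding.exists_displacement_pairing hφ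
      rw [hab _ γ₁ hc₁ hγ₁, h0]
      simp))
  have key₂ : FlatTorus.displacementMod2 γ₂ ≠ 0 := fun h0 =>
    h₂ (hmem _ (i.mem_boundarySpace_of_forall fun φ hφ => by
      obtain ⟨a, b, hab⟩ := CellularEmbedding.exists_displacement_pairing hφ
      rw [hab _ γ₂ hc₂ hγ₂, h0]
      simp))
  have key₁₂ : FlatTorus.displacementMod2 γ₁ ≠ FlatTorus.displacementMod2 γ₂ := fun h0 => by
    refine h₁₂ (sub_eq_zero.1 ?_)
    have hsub : i.homologyClass z₁ - i.homologyClass z₂ = i.homologyClass (z₁ - z₂) :=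
      (map_sub _ _ _).symm
    rw [hsub]
    refine hmem _ (i.mem_boundarySpace_of_forall fun φ hφ => ?_)
    obtain ⟨a, b, hab⟩ := CellularEmbedding.exists_displacement_pairing hφ
    have e₁ := hab _ γ₁ hc₁ hγ₁
    have e₂ := hab _ γ₂ hc₂ hγ₂
    rw [h0, ← e₂] at e₁
    simp only [AddSubgroupClass.coe_sub, Pi.sub_apply, sub_mul, Finset.sum_sub_distrib, e₁,
      sub_self]
  exact (by decide : ∀ u v : ZMod 2 × ZMod 2, u ≠ 0 → v ≠ 0 → u ≠ v →
    u.2 * v.1 - u.1 * v.2 = 1) _ _ key₁ key₂ key₁₂
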